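/- Let $M$ be a Riemann surface, $n\ge 0$ and $k\ge 2$ integers, and let $\mathcal H_+\subset L^2(S^1,\mathbb C^n)$ be the Hardy space of functions whose Fourier coefficients of negative index vanish. An *extended solution* is a smooth map $\Phi:S^1\times M\to \mathrm U(n)$ with $\Phi(1,\cdot)=I$ such that for every local complex coordinate $z$ on $M$ there are $\mathfrak{gl}(n,\mathbb C)$-valued maps $A_z,A_{\bar z}$, independent of $\lambda$, with $$\Phi(\lambda,\cdot)^{-1}d\Phi(\lambda,\cdot)=(1-\lambda^{-1})A_z\,dz+(1-\lambda)A_{\bar z}\,d\bar z\qquad(\lambda\in S^1).$$ A family $W=(W(p))_{p\in M}$ of subspaces of $L^2(S^1,\mathbb C^n)$ is also called an extended solution if there is an extended solution $\Phi$ such that $W(p)=\Phi(\cdot,p)\mathcal H_+$ for all $p\in M$. Let $\Psi:S^1\times M\to\mathrm U(n)$ be an extended solution, let $\psi=\Psi(-1,\cdot)$, and put $A_z^\psi=\tfrac12\psi^{-1}\partial_z\psi$ and $A_{\bar z}^\psi=\tfrac12\psi^{-1}\partial_{\bar z}\psi$. Let $\alpha_0\subseteq\alpha_1\subseteq\dots\subseteq\alpha_{k-2}$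 be smooth subbundles of the trivial bundle $M\times\mathbb C^n$. Then the family $$W(p)=\Psi(\lambda^k,p)\bigl(\alpha_0(p)+\lambda\alpha_1(p)+\dots+\lambda^{k-2}\alpha_{k-2}(p)+\lambda^{k-1}\mathcal H_+\bigr),\qquad p\in M,$$ is an extended solution if and only if the following three conditions hold in every local complex coordinate $z$: (i) for $0\le j<k-2$, $\partial_z\alpha_j\subseteq\alpha_{j+1}$, i.e. $\partial_z s$ lies in $\alpha_{j+1}$ for every smooth local section $s$ of $\alpha_j$; (ii) $\alpha_{k-2}\subseteq\ker A_z^\psi$ and $\operatorname{Im}A_z^\psi\subseteq\alpha_0$, at every point; (iii) for $0\le j\le k-2$, $\alpha_j$ is closed under $\partial_{\bar z}+A_{\bar z}^\psi$, i.e. $\partial_{\bar z}s+A_{\bar z}^\psi s$ lies in $\alpha_j$ for every smooth local section $s$ of $\alpha_j$. -/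

import Mathlib

open MeasureTheory
open scoped Manifold ContDiff

noncomputable section

namespace HarmonicLoop

/-- The space `ℂⁿ` with its Hermitian norm. -/
abbrev Cn (n : ℕ) : Type := EuclideanSpace ℂ (Fin n)

/-! ### The Hilbert space `L²(S¹, ℂⁿ)` and the Hardy space -/

/-- The circle parametrised by `t ∈ ℝ / ℤ`; the point of `S¹` with parameter `t` is
`λ = AddCircle.toCircle t = exp (2πi t)`. -/
abbrev Angle : Type := AddCircle (1 : ℝ)

/-- `L²(S¹, ℂⁿ)` with respect to the normalised Haar measure of the circle. -/
abbrev L2 (n : ℕ) : Type := Lp (Cn n) 2 (AddCircle.haarAddCircle (T := 1))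

theorem L2.integrable {n : ℕ} (f : L2 n) :
    Integrable (fun t : Angle => f t) AddCircle.haarAddCircle :=
  (Lp.memLp f).integrable (by norm_num)

/-- The Hardy space `H₊`: all `f ∈ L²(S¹, ℂⁿ)` whose Fourier coefficients of negative index
vanish. -/
def hardy (n : ℕ) : Submodule ℂ (L2 n) where
  carrier := {f | ∀ m : ℤ, m < 0 → fourierCoeff (fun t : Angle => f t) m = 0}
  zero_mem' := by
    intro m _
    rw [fourierCoeff_congr_ae (Lp.coeFn_zero (Cn n) 2 AddCircle.haarAddCircle)]
    simp [fourierCoeff]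
  add_mem' := by
    intro f g hf hg m hm
    rw [fourierCoeff_congr_ae (Lp.coeFn_add f g), fourierCoeff.add f.integrable g.integrable,
      Pi.add_apply, hf m hm, hg m hm, add_zero]
  smul_mem' := by
    intro c f hf m hm
    rw [fourierCoeff_congr_ae (Lp.coeFn_smul c f), fourierCoeff.const_smul, hf m hm, smul_zero]

/-- For a matrix-valued function `Θ` on `S¹` and a subspace `V` of `L²(S¹, ℂⁿ)`, the subspace
`Θ V = {Θ g : g ∈ V}`, where `(Θ g)(λ) = Θ(λ) g(λ)`. -/
def loopMul {n : ℕ} (Θ : Circle → Matrix (Fin n) (Fin n) ℂ) (V : Submodule ℂ (L2 n)) :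
    Submodule ℂ (L2 n) where
  carrier := {f | ∃ g ∈ V, ∀ᵐ t : Angle ∂AddCircle.haarAddCircle,
    f t = Matrix.toEuclideanLin (Θ (AddCircle.toCircle t)) (g t)}
  zero_mem' := by
    refine ⟨0, V.zero_mem, ?_⟩
    filter_upwards [Lp.coeFn_zero (Cn n) 2 (AddCircle.haarAddCircle (T := 1))] with t ht
    rw [ht, Pi.zero_apply, map_zero]
  add_mem' := by
    rintro f₁ f₂ ⟨g₁, hg₁, h₁⟩ ⟨g₂, hg₂, h₂⟩
    refine ⟨g₁ + g₂, V.add_mem hg₁ hg₂, ?_⟩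
    filter_upwards [h₁, h₂, Lp.coeFn_add f₁ f₂, Lp.coeFn_add g₁ g₂] with t a b c d
    rw [c, d, Pi.add_apply, Pi.add_apply, map_add, a, b]
  smul_mem' := by
    rintro c f ⟨g, hg, h⟩
    refine ⟨c • g, V.smul_mem c hg, ?_⟩
    filter_upwards [h, Lp.coeFn_smul c f, Lp.coeFn_smul c g] with t a b d
    rw [b, d, Pi.smul_apply, Pi.smul_apply, map_smul, a]

/-- The subspace `a₀ + λ a₁ + ⋯ + λ^(k-2) a_(k-2) + λ^(k-1) H₊` of `L²(S¹, ℂⁿ)` attached to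
subspaces `a₀, …, a_(k-2)` of `ℂⁿ`; the members `a j` with `j > k - 2` are not used. -/
def filteredHardy {n : ℕ} (k : ℕ) (a : ℕ → Submodule ℂ (Cn n)) : Submodule ℂ (L2 n) where
  carrier := {f | ∃ v : ℕ → Cn n, (∀ j, v j ∈ a j) ∧ ∃ h ∈ hardy n,
    ∀ᵐ t : Angle ∂AddCircle.haarAddCircle,
      f t = ∑ j ∈ Finset.range (k - 1), ((AddCircle.toCircle t : Circle) : ℂ) ^ j • v j
        + ((AddCircle.toCircle t : Circle) : ℂ) ^ (k - 1) • h t}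
  zero_mem' := by
    refine ⟨0, fun j => (a j).zero_mem, 0, (hardy n).zero_mem, ?_⟩
    exact Filter.Eventually.of_forall fun t => by simp
  add_mem' := by
    rintro f₁ f₂ ⟨v₁, hv₁, g₁, hg₁, h₁⟩ ⟨v₂, hv₂, g₂, hg₂, h₂⟩
    refine ⟨v₁ + v₂, fun j => (a j).add_mem (hv₁ j) (hv₂ j), g₁ + g₂,
      (hardy n).add_mem hg₁ hg₂, ?_⟩
    filter_upwards [h₁, h₂, Lp.coeFn_add f₁ f₂, Lp.coeFn_add g₁ g₂] with t a b c d
    rw [c, d, Pi.add_apply, Pi.add_apply, a, b]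
    simp only [Pi.add_apply, smul_add, Finset.sum_add_distrib]
    abel
  smul_mem' := by
    rintro c f ⟨v, hv, g, hg, h⟩
    refine ⟨c • v, fun j => (a j).smul_mem c (hv j), c • g, (hardy n).smul_mem c hg, ?_⟩
    filter_upwards [h, Lp.coeFn_smul c f, Lp.coeFn_smul c g] with t a b d
    rw [b, d, Pi.smul_apply, Pi.smul_apply, a, smul_add, Finset.smul_sum]
    simp only [Pi.smul_apply, smul_comm c]

/-! ### Calculus on a Riemann surface

A Riemann surface is a complex manifold modelled on `ℂ`; its local complex coordinates are the
members of the maximal holomorphic atlas. Smoothness is real `C^∞` smoothness. -/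

section Surface

variable {M : Type*} [TopologicalSpace M] [ChartedSpace ℂ M]

/-- `z` is a local complex coordinate of the Riemann surface `M`. -/
def IsCoord (z : OpenPartialHomeomorph M ℂ) : Prop :=
  z ∈ IsManifold.maximalAtlas 𝓘(ℂ) ω M

/-- `∂f/∂z = ½ (∂f/∂x - i ∂f/∂y)` in the local coordinate `z = x + i y`, at the point `p`. -/
def dz (z : OpenPartialHomeomorph M ℂ) (f : M → ℂ) (p : M) : ℂ :=
  (1 / 2) * (fderiv ℝ (fun w => f (z.symm w)) (z p) 1
    - Complex.I * fderiv ℝ (fun w => f (z.symm w)) (z p) Complex.I)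

/-- `∂f/∂z̄ = ½ (∂f/∂x + i ∂f/∂y)` in the local coordinate `z = x + i y`, at the point `p`. -/
def dzbar (z : OpenPartialHomeomorph M ℂ) (f : M → ℂ) (p : M) : ℂ :=
  (1 / 2) * (fderiv ℝ (fun w => f (z.symm w)) (z p) 1
    + Complex.I * fderiv ℝ (fun w => f (z.symm w)) (z p) Complex.I)

variable {n : ℕ}

/-- `∂_z` of a `ℂⁿ`-valued function. -/
def dzVec (z : OpenPartialHomeomorph M ℂ) (s : M → Cn n) (p : M) : Cn n :=
  WithLp.toLp 2 fun i => dz z (fun q => s q i) p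

/-- `∂_z̄` of a `ℂⁿ`-valued function. -/
def dzbarVec (z : OpenPartialHomeomorph M ℂ) (s : M → Cn n) (p : M) : Cn n :=
  WithLp.toLp 2 fun i => dzbar z (fun q => s q i) p

/-- `φ⁻¹ ∂_z φ` for a map `φ : M → U(n)`. -/
def logDz (z : OpenPartialHomeomorph M ℂ) (φ : M → Matrix.unitaryGroup (Fin n) ℂ) (p : M) :
    Matrix (Fin n) (Fin n) ℂ :=
  (((φ p)⁻¹ : Matrix.unitaryGroup (Fin n) ℂ) : Matrix (Fin n) (Fin n) ℂ) *
    Matrix.of fun i j => dz z (fun q => (φ q : Matrix (Fin n) (Fin n) ℂ) i j) p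

/-- `φ⁻¹ ∂_z̄ φ` for a map `φ : M → U(n)`. -/
def logDzbar (z : OpenPartialHomeomorph M ℂ) (φ : M → Matrix.unitaryGroup (Fin n) ℂ) (p : M) :
    Matrix (Fin n) (Fin n) ℂ :=
  (((φ p)⁻¹ : Matrix.unitaryGroup (Fin n) ℂ) : Matrix (Fin n) (Fin n) ℂ) *
    Matrix.of fun i j => dzbar z (fun q => (φ q : Matrix (Fin n) (Fin n) ℂ) i j) p

/-- `A_z^φ = ½ φ⁻¹ ∂_z φ`. -/
def connZ (z : OpenPartialHomeomorph M ℂ) (φ : M → Matrix.unitaryGroup (Fin n) ℂ) (p : M) :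
    Matrix (Fin n) (Fin n) ℂ :=
  (1 / 2 : ℂ) • logDz z φ p

/-- `A_z̄^φ = ½ φ⁻¹ ∂_z̄ φ`. -/
def connZbar (z : OpenPartialHomeomorph M ℂ) (φ : M → Matrix.unitaryGroup (Fin n) ℂ) (p : M) :
    Matrix (Fin n) (Fin n) ℂ :=
  (1 / 2 : ℂ) • logDzbar z φ p

/-! ### Extended solutions -/

/-- An extended solution `Φ : S¹ × M → U(n)`: it is smooth, `Φ(1, ·) = I`, and in every local
coordinate `Φ(λ, ·)⁻¹ dΦ(λ, ·) = (1 - λ⁻¹) A_z dz + (1 - λ) A_z̄ dz̄` for matrix-valued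
functions `A_z`, `A_z̄` that do not depend on `λ`. -/
structure IsExtendedSolution (Φ : Circle → M → Matrix.unitaryGroup (Fin n) ℂ) : Prop where
  smooth : ∀ i j, ContMDiff ((𝓡 1).prod 𝓘(ℝ, ℂ)) 𝓘(ℝ, ℂ) ∞
    (fun q : Circle × M => (Φ q.1 q.2 : Matrix (Fin n) (Fin n) ℂ) i j)
  map_one : ∀ p, Φ 1 p = 1
  eqn : ∀ z : OpenPartialHomeomorph M ℂ, IsCoord z →
    ∃ Az Azbar : M → Matrix (Fin n) (Fin n) ℂ, ∀ l : Circle, ∀ p ∈ z.source,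
      logDz z (Φ l) p = (1 - (l : ℂ)⁻¹) • Az p ∧
      logDzbar z (Φ l) p = (1 - (l : ℂ)) • Azbar p

/-- A family `W(p)`, `p ∈ M`, of subspaces of `L²(S¹, ℂⁿ)` is called an extended solution if
`W(p) = Φ(·, p) H₊` for an extended solution `Φ`. -/
def IsExtendedSolutionFamily (W : M → Submodule ℂ (L2 n)) : Prop :=
  ∃ Φ : Circle → M → Matrix.unitaryGroup (Fin n) ℂ, IsExtendedSolution Φ ∧
    ∀ p, W p = loopMul (fun l => (Φ l p : Matrix (Fin n) (Fin n) ℂ)) (hardy n)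

/-! ### Smooth subbundles of the trivial bundle `M × ℂⁿ` -/

/-- `s` is a smooth `ℂⁿ`-valued function on `U`. -/
def SmoothOn (s : M → Cn n) (U : Set M) : Prop :=
  ∀ i, ContMDiffOn 𝓘(ℝ, ℂ) 𝓘(ℝ, ℂ) ∞ (fun q => s q i) U

/-- A family of subspaces of `ℂⁿ` is a smooth subbundle if it has smooth local frames. -/
def IsSmoothSubbundle (α : M → Submodule ℂ (Cn n)) : Prop :=
  ∀ p : M, ∃ U : Set M, IsOpen U ∧ p ∈ U ∧ ∃ (r : ℕ) (s : Fin r → M → Cn n),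
    (∀ i, SmoothOn (s i) U) ∧
    ∀ q ∈ U, LinearIndependent ℂ (fun i => s i q) ∧
      Submodule.span ℂ (Set.range fun i => s i q) = α q

/-- `s` is a smooth section of `α` over `U`. -/
def IsSection (α : M → Submodule ℂ (Cn n)) (U : Set M) (s : M → Cn n) : Prop :=
  SmoothOn s U ∧ ∀ q ∈ U, s q ∈ α q

/-- `∂_z α ⊆ β`: in every local coordinate, `∂_z s` lies in `β` for all smooth local
sections `s` of `α`. -/
def DzMapsInto (α β : M → Submodule ℂ (Cn n)) : Prop :=
  ∀ z : OpenPartialHomeomorph M ℂ, IsCoord z → ∀ U : Set M, IsOpen U → U ⊆ z.source →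
    ∀ s : M → Cn n, IsSection α U s → ∀ p ∈ U, dzVec z s p ∈ β p

/-- `α` is closed under `D_z̄^ψ = ∂_z̄ + A_z̄^ψ`: in every local coordinate,
`∂_z̄ s + A_z̄^ψ s` lies in `α` for all smooth local sections `s` of `α`. -/
def ClosedUnderDzbar (ψ : M → Matrix.unitaryGroup (Fin n) ℂ)
    (α : M → Submodule ℂ (Cn n)) : Prop :=
  ∀ z : OpenPartialHomeomorph M ℂ, IsCoord z → ∀ U : Set M, IsOpen U → U ⊆ z.source →
    ∀ s : M → Cn n, IsSection α U s → ∀ p ∈ U,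
      dzbarVec z s p + Matrix.toEuclideanLin (connZbar z ψ p) (s p) ∈ α p

end Surface

end HarmonicLoop

end

open HarmonicLoop

/-! Put `K = k - 1` and complete the subbundles to a filtration `β 0 ⊆ ⋯ ⊆ β K = ℂⁿ`. Let `P_i` be
the orthogonal projection onto the complement of `β (i - 1)` in `β i`, and `G(λ) = ∑ λ^i P_i`. On
the circle `G` is a unitary loop with `G H₊` the filtered Hardy space (`loopMul_gradedLoop_hardy`),
so `W = Φ H₊` with `Φ(λ) = Ψ(λ^k) G(λ)` and `Φ(1) = I`. A continuous unitary loop normalised at `1`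
is determined by its image of `H₊` (`loop_eq_of_loopMul_hardy_eq`), so `W` is an extended solution
exactly when this particular `Φ` is one. Its smoothness comes from that of the projections
(`IsSmoothSubbundle.smooth_projMat`), and unitarity makes the `z̄`-equation the adjoint of the
`z`-equation (`isExtendedSolution_iff`).

It remains to decide when `Φ⁻¹ ∂_z Φ = (1 - λ⁻¹) B` with `B` independent of `λ`. With `A = A_z^ψ`,
`piece_mul_logDz_mul_piece` gives the block in position `(i, j)` as `(λ^(j-i) - λ^(j-i-k)) P_i A P_j
+ (λ^(j-i) - 1) P_i ∂_z P_j`. Only the exponents `0` and `-1` may survive. The exponent `j - i - k`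
is allowed only for `(i, j) = (0, K)`, which kills every other block of `A`: this is (ii). The
exponent `j - i` is forbidden for `i < j` and for `j + 2 ≤ i`. The first case gives `P_i A P_j + P_i
∂_z P_j = 0`, whose adjoint is (iii); the second gives `P_i ∂_z P_j = 0`, which is (i). Diagonal
blocks vanish automatically and the blocks `i = j + 1` are unrestricted. The coefficient comparison
is `exists_eq_smul_iff_blocks`; the translations are `ker_range_iff_blocks`, `dzMapsInto_iff_blocks`
and `closedUnderDzbar_iff_blocks`. -/

noncomputable section

namespace HarmonicLoop

/-! ### Wirtinger derivatives -/

section Wirtinger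

variable {M : Type*} [TopologicalSpace M] {m n r : ℕ} {ε : ℂ}
  {z : OpenPartialHomeomorph M ℂ} {p : M}

/-- `½ (∂f/∂x + ε ∂f/∂y)`; this is `∂_z` for `ε = -i` and `∂_z̄` for `ε = i`. -/
def wirtinger (ε : ℂ) (z : OpenPartialHomeomorph M ℂ) (f : M → ℂ) (p : M) : ℂ :=
  (1 / 2) * (fderiv ℝ (fun w => f (z.symm w)) (z p) 1
    + ε * fderiv ℝ (fun w => f (z.symm w)) (z p) Complex.I)

theorem dz_eq_wirtinger (z : OpenPartialHomeomorph M ℂ) (f : M → ℂ) (p : M) :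
    dz z f p = wirtinger (-Complex.I) z f p := by
  simp only [dz, wirtinger]; ring

/-- `f` is real differentiable at `p` when written in the coordinate `z`. -/
def DiffInCoord (z : OpenPartialHomeomorph M ℂ) (f : M → ℂ) (p : M) : Prop :=
  DifferentiableAt ℝ (fun w => f (z.symm w)) (z p)

theorem wirtinger_congr {f g : M → ℂ} (hp : p ∈ z.source) (h : f =ᶠ[nhds p] g) :
    wirtinger ε z f p = wirtinger ε z g p := by
  have h' : (fun w => f (z.symm w)) =ᶠ[nhds (z p)] fun w => g (z.symm w) := by
    have hc : Filter.Tendsto z.symm (nhds (z p)) (nhds p) := by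
      have := z.symm.continuousAt (x := z p) (z.map_source hp)
      rwa [ContinuousAt, z.left_inv hp] at this
    exact hc.eventually h
  simp only [wirtinger, h'.fderiv_eq]

theorem wirtinger_const (c : ℂ) : wirtinger ε z (fun _ => c) p = 0 := by
  simp [wirtinger]

theorem wirtinger_mul {f g : M → ℂ} (hp : p ∈ z.source) (hf : DiffInCoord z f p)
    (hg : DiffInCoord z g p) :
    wirtinger ε z (fun q => f q * g q) p
      = wirtinger ε z f p * g p + f p * wirtinger ε z g p := by
  have h := fderiv_fun_mul hf hg
  simp only [wirtinger, h, z.left_inv hp, add_apply,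
    smul_apply, smul_eq_mul]
  ring

theorem wirtinger_sum {ι : Type*} (s : Finset ι) {f : ι → M → ℂ}
    (hf : ∀ i ∈ s, DiffInCoord z (f i) p) :
    wirtinger ε z (fun q => ∑ i ∈ s, f i q) p = ∑ i ∈ s, wirtinger ε z (f i) p := by
  have h := fderiv_fun_sum (𝕜 := ℝ) (u := s) (A := fun i w => f i (z.symm w)) (x := z p) hf
  simp only [wirtinger, h, sum_apply, ← Finset.mul_sum, Finset.sum_add_distrib]

/-- Conjugation is real linear, so it commutes with `fderiv ℝ` and only the coefficient `ε` is
conjugated. For `ε = ±i` this exchanges `∂_z` and `∂_z̄`. -/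
theorem wirtinger_star (f : M → ℂ) :
    wirtinger ε z (fun q => star (f q)) p = star (wirtinger (star ε) z f p) := by
  have h := fderiv_star (𝕜 := ℝ) (f := fun w => f (z.symm w)) (x := z p)
  simp only [wirtinger, h]
  simp

theorem DiffInCoord.mul {f g : M → ℂ} (hf : DiffInCoord z f p) (hg : DiffInCoord z g p) :
    DiffInCoord z (fun q => f q * g q) p := DifferentiableAt.fun_mul hf hg

theorem DiffInCoord.sum {ι : Type*} {s : Finset ι} {f : ι → M → ℂ}
    (hf : ∀ i ∈ s, DiffInCoord z (f i) p) : DiffInCoord z (fun q => ∑ i ∈ s, f i q) p :=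
  DifferentiableAt.fun_sum hf

theorem DiffInCoord.const (c : ℂ) : DiffInCoord z (fun _ => c) p :=
  differentiableAt_const _

/-- The entrywise Wirtinger derivative of a matrix-valued function. -/
def matD (ε : ℂ) (z : OpenPartialHomeomorph M ℂ) (F : M → Matrix (Fin m) (Fin n) ℂ) (p : M) :
    Matrix (Fin m) (Fin n) ℂ :=
  Matrix.of fun i j => wirtinger ε z (fun q => F q i j) p

/-- The entrywise Wirtinger derivative of a vector-valued function. -/
def vecD (ε : ℂ) (z : OpenPartialHomeomorph M ℂ) (s : M → Cn n) (p : M) : Cn n :=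
  WithLp.toLp 2 fun i => wirtinger ε z (fun q => s q i) p

theorem dzVec_eq_vecD (z : OpenPartialHomeomorph M ℂ) (s : M → Cn n) (p : M) :
    dzVec z s p = vecD (-Complex.I) z s p := by
  simp only [dzVec, vecD, dz_eq_wirtinger]

theorem dzbarVec_eq_vecD (z : OpenPartialHomeomorph M ℂ) (s : M → Cn n) (p : M) :
    dzbarVec z s p = vecD Complex.I z s p := rfl

theorem vecD_congr {s t : M → Cn n} (hp : p ∈ z.source) (h : s =ᶠ[nhds p] t) :
    vecD ε z s p = vecD ε z t p := by
  unfold vecD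
  congr 1
  funext i
  exact wirtinger_congr hp (h.mono fun q hq => by simp only [hq])

theorem matD_const (F : Matrix (Fin m) (Fin n) ℂ) : matD ε z (fun _ => F) p = 0 := by
  ext i j
  exact wirtinger_const _

theorem matD_mul {F : M → Matrix (Fin m) (Fin n) ℂ} {G : M → Matrix (Fin n) (Fin r) ℂ}
    (hp : p ∈ z.source) (hF : ∀ i j, DiffInCoord z (fun q => F q i j) p)
    (hG : ∀ i j, DiffInCoord z (fun q => G q i j) p) :
    matD ε z (fun q => F q * G q) p = matD ε z F p * G p + F p * matD ε z G p := by
  ext i j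
  simp only [matD, Matrix.of_apply, Matrix.add_apply, Matrix.mul_apply]
  rw [wirtinger_sum _ fun l _ => (hF i l).mul (hG l j), ← Finset.sum_add_distrib]
  exact Finset.sum_congr rfl fun l _ => wirtinger_mul hp (hF i l) (hG l j)

theorem matD_const_smul (c : ℂ) {F : M → Matrix (Fin m) (Fin n) ℂ}
    (hp : p ∈ z.source) (hF : ∀ i j, DiffInCoord z (fun q => F q i j) p) :
    matD ε z (fun q => c • F q) p = c • matD ε z F p := by
  ext i j
  simp only [matD, Matrix.of_apply, Matrix.smul_apply, smul_eq_mul]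
  rw [wirtinger_mul hp (.const c) (hF i j), wirtinger_const, zero_mul, zero_add]

theorem matD_sum {ι : Type*} (s : Finset ι) {F : ι → M → Matrix (Fin m) (Fin n) ℂ}
    (hF : ∀ a ∈ s, ∀ i j, DiffInCoord z (fun q => F a q i j) p) :
    matD ε z (fun q => ∑ a ∈ s, F a q) p = ∑ a ∈ s, matD ε z (F a) p := by
  ext i j
  simp only [matD, Matrix.of_apply, Matrix.sum_apply]
  exact wirtinger_sum s fun a ha => hF a ha i j

theorem vecD_const (v : Cn n) : vecD ε z (fun _ => v) p = 0 := by
  ext i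
  exact wirtinger_const _

theorem matD_conjTranspose (F : M → Matrix (Fin m) (Fin n) ℂ) :
    matD ε z (fun q => (F q).conjTranspose) p = (matD (star ε) z F p).conjTranspose := by
  ext i j
  simp only [matD, Matrix.of_apply, Matrix.conjTranspose_apply]
  exact wirtinger_star _

theorem vecD_toEuclideanLin {F : M → Matrix (Fin m) (Fin n) ℂ} {s : M → Cn n}
    (hp : p ∈ z.source) (hF : ∀ i j, DiffInCoord z (fun q => F q i j) p)
    (hs : ∀ i, DiffInCoord z (fun q => s q i) p) :
    vecD ε z (fun q => Matrix.toEuclideanLin (F q) (s q)) p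
      = Matrix.toEuclideanLin (matD ε z F p) (s p)
        + Matrix.toEuclideanLin (F p) (vecD ε z s p) := by
  ext i
  simp only [vecD, matD, Matrix.toLpLin_apply, Matrix.mulVec, dotProduct, PiLp.add_apply,
    Matrix.of_apply]
  rw [wirtinger_sum _ fun l _ => (hF i l).mul (hs l), ← Finset.sum_add_distrib]
  exact Finset.sum_congr rfl fun l _ => wirtinger_mul hp (hF i l) (hs l)

theorem logDz_eq_matD (z : OpenPartialHomeomorph M ℂ)
    (φ : M → Matrix.unitaryGroup (Fin n) ℂ) (p : M) :
    logDz z φ p = (φ p : Matrix (Fin n) (Fin n) ℂ).conjTranspose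
      * matD (-Complex.I) z (fun q => (φ q : Matrix (Fin n) (Fin n) ℂ)) p := by
  simp only [logDz, matD, dz_eq_wirtinger]
  rfl

theorem logDzbar_eq_matD (z : OpenPartialHomeomorph M ℂ)
    (φ : M → Matrix.unitaryGroup (Fin n) ℂ) (p : M) :
    logDzbar z φ p = (φ p : Matrix (Fin n) (Fin n) ℂ).conjTranspose
      * matD Complex.I z (fun q => (φ q : Matrix (Fin n) (Fin n) ℂ)) p := rfl

theorem unitaryGroup_conjTranspose_mul (u : Matrix.unitaryGroup (Fin n) ℂ) :
    (u : Matrix (Fin n) (Fin n) ℂ).conjTranspose * (u : Matrix (Fin n) (Fin n) ℂ) = 1 :=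
  Matrix.UnitaryGroup.star_mul_self u

theorem unitaryGroup_mul_conjTranspose (u : Matrix.unitaryGroup (Fin n) ℂ) :
    (u : Matrix (Fin n) (Fin n) ℂ) * (u : Matrix (Fin n) (Fin n) ℂ).conjTranspose = 1 :=
  Matrix.mem_unitaryGroup_iff.1 u.2

theorem DiffInCoord.conj {f : M → ℂ} (hf : DiffInCoord z f p) :
    DiffInCoord z (fun q => star (f q)) p := by
  exact DifferentiableAt.star hf

/-- `φ⁻¹ ∂_z̄ φ = -(φ⁻¹ ∂_z φ)*` for unitary `φ`. -/
theorem logDzbar_eq_neg_conjTranspose {φ : M → Matrix.unitaryGroup (Fin n) ℂ}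
    (hp : p ∈ z.source)
    (hφ : ∀ i j, DiffInCoord z (fun q => (φ q : Matrix (Fin n) (Fin n) ℂ) i j) p) :
    logDzbar z φ p = -(logDz z φ p).conjTranspose := by
  -- Differentiate the constant `φ* φ = 1`.
  have h1 : matD Complex.I z (fun q => (φ q : Matrix (Fin n) (Fin n) ℂ).conjTranspose
      * (φ q : Matrix (Fin n) (Fin n) ℂ)) p = 0 := by
    simp only [unitaryGroup_conjTranspose_mul]
    exact matD_const _
  rw [matD_mul hp (fun i j => by
    simpa only [Matrix.conjTranspose_apply] using (hφ j i).conj) hφ, matD_conjTranspose] at h1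
  have hI : star Complex.I = -Complex.I := Complex.conj_I
  rw [hI] at h1
  rw [logDzbar_eq_matD, logDz_eq_matD, Matrix.conjTranspose_mul, Matrix.conjTranspose_conjTranspose]
  exact eq_neg_of_add_eq_zero_right h1

end Wirtinger

/-! ### Differentiability in an arbitrary holomorphic coordinate -/

section SmoothInCoord

variable {M : Type*} [TopologicalSpace M] [ChartedSpace ℂ M]
  {z : OpenPartialHomeomorph M ℂ} {p : M}

/-- Real smoothness is read off in the preferred chart at `p`. Passing to `z` composes with a
transition map, which is holomorphic and hence real differentiable. -/
theorem diffInCoord_of_contMDiffOn [IsManifold 𝓘(ℂ) ω M] {f : M → ℂ} {U : Set M}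
    (hf : ContMDiffOn 𝓘(ℝ, ℂ) 𝓘(ℝ, ℂ) ∞ f U) (hU : IsOpen U) (hpU : p ∈ U) (hz : IsCoord z)
    (hp : p ∈ z.source) : DiffInCoord z f p := by
  have h1 : ContMDiffAt 𝓘(ℝ, ℂ) 𝓘(ℝ, ℂ) ∞ f p := hf.contMDiffAt (hU.mem_nhds hpU)
  have h2 := (contMDiffAt_iff.1 h1).2
  have h3 : ContDiffAt ℝ ∞ (fun w => f ((chartAt ℂ p).symm w)) (chartAt ℂ p p) := by
    simpa [contDiffWithinAt_univ, Function.comp_def, chartAt_self_eq] using h2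
  have h4 : ContDiffAt ℝ ω (fun w => chartAt ℂ p (z.symm w)) (z p) := by
    have ha : ContMDiffAt 𝓘(ℂ) 𝓘(ℂ) ω z.symm (z p) :=
      contMDiffAt_symm_of_mem_maximalAtlas hz (z.map_source hp)
    have hb : ContMDiffAt 𝓘(ℂ) 𝓘(ℂ) ω (chartAt ℂ p) (z.symm (z p)) := by
      rw [z.left_inv hp]
      exact contMDiffAt_of_mem_maximalAtlas (IsManifold.chart_mem_maximalAtlas p)
        (mem_chart_source ℂ p)
    exact (contMDiffAt_iff_contDiffAt.1 (hb.comp (z p) ha)).restrict_scalars ℝ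
  have h5 : DifferentiableAt ℝ
      (fun w => f ((chartAt ℂ p).symm (chartAt ℂ p (z.symm w)))) (z p) := by
    have h3' : DifferentiableAt ℝ (fun w => f ((chartAt ℂ p).symm w))
        ((fun w => chartAt ℂ p (z.symm w)) (z p)) := by
      simpa only [z.left_inv hp] using h3.differentiableAt (by simp)
    exact DifferentiableAt.comp (g := fun w => f ((chartAt ℂ p).symm w)) (z p) h3'
      (h4.differentiableAt (by simp))
  refine h5.congr_of_eventuallyEq ?_
  have hc : Filter.Tendsto z.symm (nhds (z p)) (nhds p) := by
    have := z.symm.continuousAt (x := z p) (z.map_source hp)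
    rwa [ContinuousAt, z.left_inv hp] at this
  filter_upwards [hc ((chartAt ℂ p).open_source.mem_nhds (mem_chart_source ℂ p))] with w hw
  rw [(chartAt ℂ p).left_inv hw]

end SmoothInCoord

/-! ### Orthogonal projections as matrices -/

section Projection

variable {n : ℕ}

theorem toEuclideanLin_mul_apply {l m r : ℕ} (A : Matrix (Fin l) (Fin m) ℂ)
    (B : Matrix (Fin m) (Fin r) ℂ) (x : Cn r) :
    Matrix.toEuclideanLin (A * B) x = Matrix.toEuclideanLin A (Matrix.toEuclideanLin B x) := by
  simp [Matrix.toLpLin_apply, Matrix.mulVec_mulVec]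

theorem toEuclideanLin_one_apply (x : Cn n) :
    Matrix.toEuclideanLin (1 : Matrix (Fin n) (Fin n) ℂ) x = x := by
  simp

theorem matrix_ext_of_toEuclideanLin {l m : ℕ} {A B : Matrix (Fin l) (Fin m) ℂ}
    (h : ∀ x, Matrix.toEuclideanLin A x = Matrix.toEuclideanLin B x) : A = B :=
  Matrix.toEuclideanLin.injective (LinearMap.ext h)

/-- The matrix of the orthogonal projection of `ℂⁿ` onto `V`. -/
def projMat (V : Submodule ℂ (Cn n)) : Matrix (Fin n) (Fin n) ℂ :=
  Matrix.toEuclideanLin.symm (V.starProjection : Cn n →ₗ[ℂ] Cn n)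

theorem toEuclideanLin_projMat (V : Submodule ℂ (Cn n)) (x : Cn n) :
    Matrix.toEuclideanLin (projMat V) x = V.starProjection x := by
  simp [projMat]

theorem projMat_apply_mem (V : Submodule ℂ (Cn n)) (x : Cn n) :
    Matrix.toEuclideanLin (projMat V) x ∈ V := by
  rw [toEuclideanLin_projMat]
  exact V.starProjection_apply_mem x

theorem projMat_apply_eq_self_iff {V : Submodule ℂ (Cn n)} {x : Cn n} :
    Matrix.toEuclideanLin (projMat V) x = x ↔ x ∈ V := by
  rw [toEuclideanLin_projMat, Submodule.starProjection_eq_self_iff]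

theorem projMat_top : projMat (⊤ : Submodule ℂ (Cn n)) = 1 :=
  matrix_ext_of_toEuclideanLin fun x => by
    rw [projMat_apply_eq_self_iff.2 Submodule.mem_top, toEuclideanLin_one_apply]

theorem conjTranspose_projMat (V : Submodule ℂ (Cn n)) :
    (projMat V).conjTranspose = projMat V := by
  have h : (Matrix.toEuclideanLin (projMat V)).IsSymmetric := by
    intro x y
    simp only [toEuclideanLin_projMat]
    exact V.inner_starProjection_left_eq_right x y
  exact Matrix.isSymmetric_toEuclideanLin_iff.1 h

theorem projMat_mul_of_le {V W : Submodule ℂ (Cn n)} (h : V ≤ W) :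
    projMat W * projMat V = projMat V :=
  matrix_ext_of_toEuclideanLin fun x => by
    rw [toEuclideanLin_mul_apply, projMat_apply_eq_self_iff]
    exact h (projMat_apply_mem V x)

/-- A Hermitian matrix whose image lies in `V` and which fixes `V` is the projection onto `V`. -/
theorem eq_projMat {V : Submodule ℂ (Cn n)} {R : Matrix (Fin n) (Fin n) ℂ}
    (hR : R.conjTranspose = R) (hmem : ∀ x, Matrix.toEuclideanLin R x ∈ V)
    (hfix : ∀ x ∈ V, Matrix.toEuclideanLin R x = x) : R = projMat V := by
  have h1 : projMat V * R = R := matrix_ext_of_toEuclideanLin fun x => by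
    rw [toEuclideanLin_mul_apply, projMat_apply_eq_self_iff]; exact hmem x
  have h2 : R * projMat V = projMat V := matrix_ext_of_toEuclideanLin fun x => by
    rw [toEuclideanLin_mul_apply]; exact hfix _ (projMat_apply_mem V x)
  -- The adjoint of `R Π = Π` is `Π R = Π`, while `Π R = R` by `h1`.
  have h3 := congrArg Matrix.conjTranspose h2
  rw [Matrix.conjTranspose_mul, conjTranspose_projMat, hR, h1] at h3
  exact h3

open scoped ComplexOrder in
/-- The projection onto the span of a frame in terms of the Gram matrix of the frame. -/
theorem projMat_span_range {r : ℕ} {s : Fin r → Cn n} (hs : LinearIndependent ℂ s)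
    {S : Matrix (Fin n) (Fin r) ℂ} (hS : ∀ i j, S i j = s j i) :
    projMat (Submodule.span ℂ (Set.range s))
      = S * ((S.conjTranspose * S)⁻¹ * S.conjTranspose) := by
  have hSc : ∀ c : Cn r, Matrix.toEuclideanLin S c = ∑ j, c j • s j := by
    intro c
    ext i
    simp [Matrix.toLpLin_apply, Matrix.mulVec, dotProduct, hS, mul_comm]
  have hinj : Function.Injective S.mulVec := by
    refine (injective_iff_map_eq_zero S.mulVecLin).2 fun c hc => ?_
    have h0 : ∑ j, c j • s j = 0 := by
      rw [← hSc (WithLp.toLp 2 c), Matrix.toLpLin_apply]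
      simpa using hc
    exact funext (Fintype.linearIndependent_iff.1 hs c h0)
  -- Independence of the frame makes the Gram matrix `S* S` positive definite, hence invertible.
  have hG := Matrix.PosDef.conjTranspose_mul_self S hinj
  have hdet : IsUnit (S.conjTranspose * S).det := (Matrix.isUnit_iff_isUnit_det _).1 hG.isUnit
  symm
  refine eq_projMat ?_ ?_ ?_
  · rw [Matrix.conjTranspose_mul, Matrix.conjTranspose_mul, Matrix.conjTranspose_nonsing_inv,
      Matrix.conjTranspose_mul, Matrix.conjTranspose_conjTranspose, Matrix.mul_assoc]
  · intro x
    rw [toEuclideanLin_mul_apply, hSc]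
    exact Submodule.sum_mem _ fun j _ =>
      Submodule.smul_mem _ _ (Submodule.subset_span ⟨j, rfl⟩)
  · intro x hx
    obtain ⟨c, rfl⟩ := (Submodule.mem_span_range_iff_exists_fun ℂ).1 hx
    rw [← hSc (WithLp.toLp 2 c), ← toEuclideanLin_mul_apply]
    congr 2
    rw [Matrix.mul_assoc, Matrix.mul_assoc, Matrix.nonsing_inv_mul _ hdet, Matrix.mul_one]

end Projection

/-! ### Smoothness of the projections onto a smooth subbundle -/

section SmoothProjection

variable {M : Type*} [TopologicalSpace M] [ChartedSpace ℂ M] {n : ℕ} {U : Set M}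

instance contMDiffMul_complex_over_real : ContMDiffMul 𝓘(ℝ, ℂ) ∞ ℂ where
  toIsManifold := inferInstance
  contMDiff_mul := by
    rw [contMDiff_iff]
    refine ⟨continuous_mul, fun x y => ?_⟩
    simp only [mfld_simps, chartAt_self_eq]
    rw [contDiffOn_univ]
    exact contDiff_mul

/-- A matrix-valued function with smooth entries on `U`. -/
def MatSmoothOn {m r : ℕ} (F : M → Matrix (Fin m) (Fin r) ℂ) (U : Set M) : Prop :=
  ∀ i j, ContMDiffOn 𝓘(ℝ, ℂ) 𝓘(ℝ, ℂ) ∞ (fun q => F q i j) U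

theorem MatSmoothOn.mul {m l r : ℕ} {F : M → Matrix (Fin m) (Fin l) ℂ}
    {G : M → Matrix (Fin l) (Fin r) ℂ} (hF : MatSmoothOn F U) (hG : MatSmoothOn G U) :
    MatSmoothOn (fun q => F q * G q) U := by
  intro i j
  simp only [Matrix.mul_apply]
  exact contMDiffOn_finsetSum fun a _ => (hF i a).mul (hG a j)

theorem MatSmoothOn.conjTranspose {m r : ℕ} {F : M → Matrix (Fin m) (Fin r) ℂ}
    (hF : MatSmoothOn F U) : MatSmoothOn (fun q => (F q).conjTranspose) U := fun i j =>
  (Complex.conjCLE.contDiff.contMDiff.contMDiffOn (s := Set.univ)).comp (hF j i)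
    fun _ _ => Set.mem_univ _

theorem MatSmoothOn.det {m : ℕ} {F : M → Matrix (Fin m) (Fin m) ℂ} (hF : MatSmoothOn F U) :
    ContMDiffOn 𝓘(ℝ, ℂ) 𝓘(ℝ, ℂ) ∞ (fun q => (F q).det) U := by
  simp only [Matrix.det_apply']
  exact contMDiffOn_finsetSum fun σ _ =>
    contMDiffOn_const.mul (contMDiffOn_finsetProd fun i _ => hF _ _)

/-- By Cramer's rule the entries are determinants of smooth matrices divided by the nonvanishing
`det F`. -/
theorem MatSmoothOn.inv {m : ℕ} {F : M → Matrix (Fin m) (Fin m) ℂ} (hF : MatSmoothOn F U)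
    (h0 : ∀ q ∈ U, (F q).det ≠ 0) : MatSmoothOn (fun q => (F q)⁻¹) U := by
  intro i j
  simp only [Matrix.inv_def, Ring.inverse_eq_inv', Matrix.smul_apply, smul_eq_mul,
    Matrix.adjugate_apply]
  refine ContMDiffOn.mul (fun q hq => ?_) (MatSmoothOn.det fun a b => ?_)
  · exact ContDiffAt.comp_contMDiffWithinAt (f := fun q => (F q).det)
      (contDiffAt_inv ℝ (h0 q hq)) (hF.det q hq)
  · by_cases hab : a = j
    · simp only [hab, Matrix.updateRow_self]
      exact contMDiffOn_const
    · simp only [Matrix.updateRow_ne hab]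
      exact hF a b

-- For a local frame `S` the projection is `S (S* S)⁻¹ S*`, a smooth expression in the frame.
open scoped ComplexOrder in
theorem IsSmoothSubbundle.smooth_projMat {α : M → Submodule ℂ (Cn n)}
    (hα : IsSmoothSubbundle α) : MatSmoothOn (fun q => projMat (α q)) Set.univ := by
  intro i j q _
  obtain ⟨U, hU, hqU, r, s, hs, hfr⟩ := hα q
  let S : M → Matrix (Fin n) (Fin r) ℂ := fun q => Matrix.of fun a b => s b q a
  have hS : MatSmoothOn S U := fun a b => hs b a
  have hdet : ∀ q ∈ U, ((S q).conjTranspose * S q).det ≠ 0 := by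
    intro q hq
    have hinj : Function.Injective (S q).mulVec := by
      refine (injective_iff_map_eq_zero (S q).mulVecLin).2 fun c hc => ?_
      refine funext (Fintype.linearIndependent_iff.1 (hfr q hq).1 c ?_)
      ext a
      have := congrFun hc a
      simpa [S, Matrix.mulVec, dotProduct, mul_comm] using this
    have hG := Matrix.PosDef.conjTranspose_mul_self (S q) hinj
    exact ((Matrix.isUnit_iff_isUnit_det _).1 hG.isUnit).ne_zero
  have hsm := hS.mul (((hS.conjTranspose.mul hS).inv hdet).mul hS.conjTranspose)
  have hon : ContMDiffOn 𝓘(ℝ, ℂ) 𝓘(ℝ, ℂ) ∞ (fun q => projMat (α q) i j) U := by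
    refine (hsm i j).congr fun q hq => ?_
    rw [← (hfr q hq).2, projMat_span_range (hfr q hq).1 (S := S q) fun a b => rfl]
  exact (hon.contMDiffAt (hU.mem_nhds hqU)).contMDiffWithinAt

end SmoothProjection

/-! ### The graded pieces of a filtration -/

section Pieces

variable {n : ℕ} {β : ℕ → Submodule ℂ (Cn n)}

/-- The projection onto the orthogonal complement of `β (i - 1)` in `β i`. -/
def piece (β : ℕ → Submodule ℂ (Cn n)) : ℕ → Matrix (Fin n) (Fin n) ℂ
  | 0 => projMat (β 0)
  | i + 1 => projMat (β (i + 1)) - projMat (β i)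

theorem conjTranspose_piece (i : ℕ) : (piece β i).conjTranspose = piece β i := by
  cases i <;> simp [piece, conjTranspose_projMat]

/-- The sum telescopes. -/
theorem sum_piece (j : ℕ) : ∑ i ∈ Finset.range (j + 1), piece β i = projMat (β j) := by
  induction j with
  | zero => simp [piece]
  | succ j ih => rw [Finset.sum_range_succ, ih, piece]; abel

theorem projMat_mul_piece (hβ : Monotone β) {i j : ℕ} (h : i ≤ j) :
    projMat (β j) * piece β i = piece β i := by
  cases i with
  | zero => exact projMat_mul_of_le (hβ h)
  | succ i => rw [piece, mul_sub, projMat_mul_of_le (hβ h),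
      projMat_mul_of_le (hβ ((Nat.le_succ i).trans h))]

theorem piece_mul_projMat_of_lt (hβ : Monotone β) {i j : ℕ} (h : j < i) :
    piece β i * projMat (β j) = 0 := by
  obtain ⟨i, rfl⟩ : ∃ i', i = i' + 1 := ⟨i - 1, by omega⟩
  rw [piece, sub_mul, projMat_mul_of_le (hβ h.le), projMat_mul_of_le (hβ (Nat.lt_succ_iff.1 h)),
    sub_self]

theorem piece_mul_of_lt (hβ : Monotone β) {i j : ℕ} (h : i < j) : piece β j * piece β i = 0 := by
  rw [← projMat_mul_piece hβ (le_refl i), ← mul_assoc, piece_mul_projMat_of_lt hβ h, zero_mul]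

theorem piece_mul_of_ne (hβ : Monotone β) {i j : ℕ} (h : i ≠ j) : piece β i * piece β j = 0 := by
  rcases lt_or_gt_of_ne h with h | h
  · have := congrArg Matrix.conjTranspose (piece_mul_of_lt hβ h)
    simpa only [Matrix.conjTranspose_mul, conjTranspose_piece, Matrix.conjTranspose_zero] using this
  · exact piece_mul_of_lt hβ h

theorem piece_mul_self (hβ : Monotone β) (i : ℕ) : piece β i * piece β i = piece β i := by
  cases i with
  | zero => exact projMat_mul_of_le le_rfl
  | succ i =>
    nth_rw 1 [piece]
    rw [sub_mul, projMat_mul_piece hβ le_rfl]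
    have := congrArg Matrix.conjTranspose (piece_mul_projMat_of_lt hβ (Nat.lt_succ_self i))
    simp only [Matrix.conjTranspose_mul, conjTranspose_projMat, conjTranspose_piece,
      Matrix.conjTranspose_zero] at this
    rw [this, sub_zero]

theorem piece_apply_mem (hβ : Monotone β) {i j : ℕ} (h : i ≤ j) (x : Cn n) :
    Matrix.toEuclideanLin (piece β i) x ∈ β j := by
  rw [← projMat_mul_piece hβ h, toEuclideanLin_mul_apply]
  exact projMat_apply_mem _ _

theorem piece_apply_eq_zero (hβ : Monotone β) {i j : ℕ} (h : j < i) {x : Cn n} (hx : x ∈ β j) :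
    Matrix.toEuclideanLin (piece β i) x = 0 := by
  rw [← projMat_apply_eq_self_iff.2 hx, ← toEuclideanLin_mul_apply, piece_mul_projMat_of_lt hβ h,
    map_zero, LinearMap.zero_apply]

theorem sum_piece_eq_one {K : ℕ} (hK : β K = ⊤) :
    ∑ i ∈ Finset.range (K + 1), piece β i = 1 := by
  rw [sum_piece, hK, projMat_top]

theorem toEuclideanLin_sum_apply {ι : Type*} (s : Finset ι) (F : ι → Matrix (Fin n) (Fin n) ℂ)
    (x : Cn n) :
    Matrix.toEuclideanLin (∑ i ∈ s, F i) x = ∑ i ∈ s, Matrix.toEuclideanLin (F i) x := by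
  rw [map_sum, LinearMap.sum_apply]

/-- The pieces up to `K` resolve the identity, so `β j` is cut out by the components above `j`. This
turns conditions (i) and (iii) into vanishing of blocks. -/
theorem mem_iff_piece_apply_eq_zero (hβ : Monotone β) {K j : ℕ} (hK : β K = ⊤) {x : Cn n} :
    x ∈ β j ↔ ∀ i, j < i → i ≤ K → Matrix.toEuclideanLin (piece β i) x = 0 := by
  refine ⟨fun hx i hi _ => piece_apply_eq_zero hβ hi hx, fun h => ?_⟩
  rw [← toEuclideanLin_one_apply x, ← sum_piece_eq_one hK, toEuclideanLin_sum_apply]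
  refine Submodule.sum_mem _ fun i hi => ?_
  rcases le_or_gt i j with hij | hij
  · exact piece_apply_mem hβ hij x
  · rw [h i hij (Nat.lt_succ_iff.1 (Finset.mem_range.1 hi))]
    exact Submodule.zero_mem _

/-- The polynomial loop `∑ λ^i P_i` whose coefficients are the graded pieces. -/
def gradedLoop (β : ℕ → Submodule ℂ (Cn n)) (K : ℕ) (l : ℂ) : Matrix (Fin n) (Fin n) ℂ :=
  ∑ i ∈ Finset.range (K + 1), l ^ i • piece β i

/-- The pieces are mutually orthogonal idempotents, so the loop is diagonal with eigenvalue `λ^j` on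
the image of `P_j`. -/
theorem gradedLoop_mul_piece (hβ : Monotone β) {K j : ℕ} (hj : j ≤ K) (l : ℂ) :
    gradedLoop β K l * piece β j = l ^ j • piece β j := by
  rw [gradedLoop, Finset.sum_mul, Finset.sum_eq_single j]
  · rw [smul_mul_assoc, piece_mul_self hβ]
  · intro i _ hij
    rw [smul_mul_assoc, piece_mul_of_ne hβ hij, smul_zero]
  · intro h
    exact absurd (Finset.mem_range.2 (Nat.lt_succ_iff.2 hj)) h

theorem conjTranspose_gradedLoop (K : ℕ) (l : ℂ) :
    (gradedLoop β K l).conjTranspose = gradedLoop β K (star l) := by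
  simp only [gradedLoop, Matrix.conjTranspose_sum, Matrix.conjTranspose_smul, conjTranspose_piece,
    star_pow]

theorem piece_mul_gradedLoop (hβ : Monotone β) {K j : ℕ} (hj : j ≤ K) (l : ℂ) :
    piece β j * gradedLoop β K l = l ^ j • piece β j := by
  have := congrArg Matrix.conjTranspose (gradedLoop_mul_piece hβ hj (star l))
  simpa only [Matrix.conjTranspose_mul, conjTranspose_gradedLoop, conjTranspose_piece,
    Matrix.conjTranspose_smul, star_pow, star_star] using this

/-- Eigenvalues multiply. On the circle the value at `λ⁻¹ = λ̄` is therefore both the inverse and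
the adjoint of the value at `λ`. -/
theorem gradedLoop_mul (hβ : Monotone β) {K : ℕ} (a b : ℂ) :
    gradedLoop β K a * gradedLoop β K b = gradedLoop β K (a * b) := by
  conv_lhs => rw [gradedLoop.eq_1 β K b, Finset.mul_sum]
  rw [gradedLoop.eq_1 β K (a * b)]
  refine Finset.sum_congr rfl fun i hi => ?_
  rw [mul_smul_comm, gradedLoop_mul_piece hβ (Nat.lt_succ_iff.1 (Finset.mem_range.1 hi)), smul_smul,
    mul_pow, mul_comm]

theorem gradedLoop_one {K : ℕ} (hK : β K = ⊤) : gradedLoop β K 1 = 1 := by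
  simp only [gradedLoop, one_pow, one_smul, sum_piece_eq_one hK]

theorem gradedLoop_mem_unitaryGroup (hβ : Monotone β) {K : ℕ} (hK : β K = ⊤) (l : Circle) :
    gradedLoop β K l ∈ Matrix.unitaryGroup (Fin n) ℂ := by
  rw [Matrix.mem_unitaryGroup_iff, Matrix.star_eq_conjTranspose, conjTranspose_gradedLoop,
    gradedLoop_mul hβ]
  have : (l : ℂ) * star (l : ℂ) = 1 := by
    have := Complex.mul_conj (l : ℂ)
    simpa [Circle.normSq_coe] using this
  rw [this, gradedLoop_one hK]

end Pieces

/-! ### Fourier coefficients of vector-valued functions -/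

section FourierCoeff

variable {E F : Type*} [NormedAddCommGroup E] [NormedSpace ℂ E] [NormedAddCommGroup F]
  [NormedSpace ℂ F]

theorem toCircle_pow_eq_fourier (t : Angle) (j : ℕ) :
    ((AddCircle.toCircle t : Circle) : ℂ) ^ j = fourier (j : ℤ) t := by
  rw [fourier_apply, natCast_zsmul, AddCircle.toCircle_nsmul, Circle.coe_pow]

theorem toCircle_zpow_eq_fourier (t : Angle) (j : ℤ) :
    ((AddCircle.toCircle t : Circle) : ℂ) ^ j = fourier j t := by
  rw [fourier_apply, AddCircle.toCircle_zsmul, Circle.coe_zpow]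

theorem fourierCoeff_fourier_smul (f : Angle → E) (a m : ℤ) :
    fourierCoeff (fun t => fourier a t • f t) m = fourierCoeff f (m - a) := by
  simp only [fourierCoeff, smul_smul]
  refine integral_congr_ae (Filter.Eventually.of_forall fun t => ?_)
  simp only
  rw [← fourier_add, neg_sub, sub_eq_add_neg, add_comm]

theorem fourierCoeff_clm [CompleteSpace E] [CompleteSpace F] (L : E →L[ℂ] F) {f : Angle → E}
    (hf : Integrable f AddCircle.haarAddCircle) (m : ℤ) :
    fourierCoeff (fun t => L (f t)) m = L (fourierCoeff f m) := by
  simp only [fourierCoeff]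
  rw [← L.integral_comp_comm (hf.fourier_smul _)]
  simp only [map_smul]

theorem fourierCoeff_const [CompleteSpace E] (v : E) (m : ℤ) :
    fourierCoeff (fun _ : Angle => v) m = if m = 0 then v else 0 := by
  have h := congrFun (fourierCoeff_fourier (T := 1) 0) m
  simp only [fourierCoeff, smul_eq_mul, fourier_zero, mul_one] at h ⊢
  rw [integral_smul_const, h, Pi.single_apply]
  split_ifs <;> simp

theorem fourierCoeff_fourier_smul_const [CompleteSpace E] (v : E) (a m : ℤ) :
    fourierCoeff (fun t : Angle => fourier a t • v) m = if m = a then v else 0 := by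
  rw [fourierCoeff_fourier_smul, fourierCoeff_const]
  simp only [sub_eq_zero]

theorem fourierCoeff_star (f : Angle → ℂ) (m : ℤ) :
    fourierCoeff (fun t => star (f t)) m = star (fourierCoeff f (-m)) := by
  simp only [fourierCoeff, smul_eq_mul]
  rw [Complex.star_def, ← integral_conj]
  refine integral_congr_ae (Filter.Eventually.of_forall fun t => ?_)
  simp only [map_mul, fourier_neg, Complex.conj_conj]

theorem integrable_of_continuous {G : Type*} [NormedAddCommGroup G] {f : Angle → G}
    (hf : Continuous f) :
    Integrable f AddCircle.haarAddCircle :=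
  hf.integrable_of_hasCompactSupport (HasCompactSupport.of_compactSpace f)

theorem integrable_fourier_smul_const (a : ℤ) (v : E) :
    Integrable (fun t : Angle => fourier a t • v) AddCircle.haarAddCircle :=
  integrable_of_continuous (by fun_prop)

/-- A Laurent polynomial with four terms that vanishes on the circle has vanishing coefficients. -/
theorem laurent_coeff_eq_zero {a b c d : ℂ} {i j k l : ℤ}
    (h : ∀ x : Circle, (x : ℂ) ^ i * a + (x : ℂ) ^ j * b + (x : ℂ) ^ k * c + (x : ℂ) ^ l * d = 0)
    (m : ℤ) :
    (if m = i then a else 0) + (if m = j then b else 0) + (if m = k then c else 0)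
      + (if m = l then d else 0) = 0 := by
  have h0 : fourierCoeff ((((fun t : Angle => fourier i t • a) + fun t : Angle => fourier j t • b)
      + fun t : Angle => fourier k t • c) + fun t : Angle => fourier l t • d) m = 0 := by
    have : ((((fun t : Angle => fourier i t • a) + fun t : Angle => fourier j t • b)
      + fun t : Angle => fourier k t • c) + fun t : Angle => fourier l t • d) = fun _ => 0 := by
      funext t
      simpa only [toCircle_zpow_eq_fourier, Pi.add_apply, smul_eq_mul] using
        h (AddCircle.toCircle t)
    rw [this, fourierCoeff_const]
    simp
  have hi := fun (a : ℤ) (v : ℂ) => integrable_fourier_smul_const a v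
  rw [fourierCoeff.add (((hi i a).add (hi j b)).add (hi k c)) (hi l d),
    Pi.add_apply, fourierCoeff.add ((hi i a).add (hi j b)) (hi k c), Pi.add_apply,
    fourierCoeff.add (hi i a) (hi j b), Pi.add_apply] at h0
  simpa only [fourierCoeff_fourier_smul_const] using h0

/-- A continuous function on the circle whose only nonzero Fourier coefficient is the zeroth one
is constant. -/
theorem eq_of_fourierCoeff_eq_zero {f : Angle → ℂ} (hf : Continuous f)
    (h : ∀ m : ℤ, m ≠ 0 → fourierCoeff f m = 0) (t : Angle) : f t = f 0 := by
  have key : ∀ t, f t = fourierCoeff f 0 := by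
    intro t
    -- Finitely supported coefficients are summable, so the Fourier series of the continuous `f`
    -- converges to it at every point.
    have hs : Summable (fourierCoeff (⟨f, hf⟩ : C(Angle, ℂ))) :=
      summable_of_ne_finset_zero (s := {0}) fun m hm => h m (by simpa using hm)
    have h1 := has_pointwise_sum_fourier_series_of_summable hs t
    have h2 : HasSum (fun m => fourierCoeff (⟨f, hf⟩ : C(Angle, ℂ)) m • fourier m t)
        (fourierCoeff f 0 • fourier 0 t) :=
      hasSum_single 0 fun m hm => by
        have : fourierCoeff (⟨f, hf⟩ : C(Angle, ℂ)) m = 0 := h m hm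
        rw [this, zero_smul]
    have := h1.unique h2
    simpa using this
  rw [key t, key 0]

end FourierCoeff

/-! ### Loops acting on the Hardy space -/

section Loops

variable {n : ℕ}

/-- The entries of `Θ` are bounded because the circle is compact; the product is split into its
elementary matrix terms. -/
theorem memLp_toEuclideanLin {Θ : Angle → Matrix (Fin n) (Fin n) ℂ}
    (hΘ : ∀ i j, Continuous fun t => Θ t i j) {g : Angle → Cn n}
    (hg : MemLp g 2 AddCircle.haarAddCircle) :
    MemLp (fun t => Matrix.toEuclideanLin (Θ t) (g t)) 2 AddCircle.haarAddCircle := by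
  have hterm : ∀ i j, MemLp (fun t => Θ t i j • (EuclideanSpace.single i (g t j) : Cn n)) 2
      AddCircle.haarAddCircle := by
    intro i j
    let L : Cn n →L[ℂ] Cn n := LinearMap.toContinuousLinearMap
      (Matrix.toEuclideanLin (Matrix.single i j (1 : ℂ)))
    have hL : ∀ x : Cn n, L x = EuclideanSpace.single i (x j) := by
      intro x
      ext a
      by_cases h : a = i <;>
        simp [L, Matrix.toLpLin_apply, Matrix.single_mulVec, h]
    have h1 : MemLp (fun t => (EuclideanSpace.single i (g t j) : Cn n)) 2
        AddCircle.haarAddCircle := by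
      have := L.comp_memLp' hg
      simpa only [Function.comp_def, hL] using this
    obtain ⟨C, hC⟩ := (isCompact_range (hΘ i j)).isBounded.exists_norm_le
    refine h1.of_le_mul (c := C)
      ((hΘ i j).aestronglyMeasurable.smul h1.aestronglyMeasurable)
      (Filter.Eventually.of_forall fun t => ?_)
    rw [norm_smul]
    exact mul_le_mul_of_nonneg_right (hC _ ⟨t, rfl⟩) (norm_nonneg _)
  have hsum := memLp_finsetSum Finset.univ fun i _ =>
    memLp_finsetSum Finset.univ fun j _ => hterm i j
  refine hsum.ae_eq (Filter.Eventually.of_forall fun t => ?_)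
  ext a
  simp [Matrix.toLpLin_apply, Matrix.mulVec, dotProduct, Pi.single_apply, Finset.sum_apply]

theorem toLp_mem_hardy {g : Angle → Cn n} (hg : MemLp g 2 AddCircle.haarAddCircle)
    (h : ∀ m : ℤ, m < 0 → fourierCoeff g m = 0) : hg.toLp g ∈ hardy n := fun m hm => by
  rw [fourierCoeff_congr_ae hg.coeFn_toLp, h m hm]

theorem memLp_fourier_smul (a : ℤ) {g : Angle → Cn n}
    (hg : MemLp g 2 AddCircle.haarAddCircle) :
    MemLp (fun t : Angle => fourier a t • g t) 2 AddCircle.haarAddCircle := by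
  refine hg.of_le ((by fun_prop : Continuous fun t : Angle =>
    fourier a t).aestronglyMeasurable.smul hg.aestronglyMeasurable)
    (Filter.Eventually.of_forall fun t => ?_)
  rw [norm_smul, fourier_apply, Circle.norm_coe, one_mul]

theorem memLp_const_angle (v : Cn n) : MemLp (fun _ : Angle => v) 2 AddCircle.haarAddCircle :=
  memLp_const v

/-- Membership in `a₀ + λ a₁ + ⋯ + λ^(k-2) a_(k-2) + λ^(k-1) H₊` in terms of Fourier
coefficients. -/
theorem mem_filteredHardy_iff {k : ℕ} {a : ℕ → Submodule ℂ (Cn n)} {f : L2 n} :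
    f ∈ filteredHardy k a ↔
      (∀ m : ℤ, m < 0 → fourierCoeff (fun t : Angle => f t) m = 0) ∧
      ∀ j : ℕ, j < k - 1 → fourierCoeff (fun t : Angle => f t) j ∈ a j := by
  have hcoef : ∀ (v : ℕ → Cn n) (m : ℤ),
      fourierCoeff (∑ j ∈ Finset.range (k - 1), fun t : Angle => fourier (j : ℤ) t • v j) m
        = ∑ j ∈ Finset.range (k - 1), if m = j then v j else 0 := by
    intro v m
    rw [fourierCoeff.sum _ _ fun j _ => integrable_fourier_smul_const _ _, Finset.sum_apply]
    simp only [fourierCoeff_fourier_smul_const]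
  constructor
  · rintro ⟨v, hv, h, hh, hf⟩
    have hf' : (fun t : Angle => f t) =ᵐ[AddCircle.haarAddCircle]
        (∑ j ∈ Finset.range (k - 1), fun t : Angle => fourier (j : ℤ) t • v j)
          + fun t : Angle => fourier ((k - 1 : ℕ) : ℤ) t • h t := by
      filter_upwards [hf] with t ht
      rw [ht]
      simp only [toCircle_pow_eq_fourier, Pi.add_apply, Finset.sum_apply]
    have hm : ∀ m : ℤ, fourierCoeff (fun t : Angle => f t) m
        = (∑ j ∈ Finset.range (k - 1), if m = j then v j else 0)
          + fourierCoeff (fun t : Angle => h t) (m - (k - 1 : ℕ)) := by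
      intro m
      rw [fourierCoeff_congr_ae hf', fourierCoeff.add
        (integrable_finsetSum' _ fun j _ => integrable_fourier_smul_const _ _)
        (h.integrable.fourier_smul _), Pi.add_apply, hcoef, fourierCoeff_fourier_smul]
    refine ⟨fun m hm0 => ?_, fun j hj => ?_⟩
    · rw [hm, hh _ (by omega), add_zero]
      exact Finset.sum_eq_zero fun j _ => if_neg (by omega)
    · rw [hm, hh _ (by omega), add_zero, Finset.sum_eq_single j]
      · simpa using hv j
      · intro i _ hij
        exact if_neg (by exact_mod_cast hij.symm)
      · intro h
        exact absurd (Finset.mem_range.2 hj) h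
  · rintro ⟨hneg, hmem⟩
    -- The `v j` are the low Fourier coefficients of `f`, set to `0` from `k - 1` on so that they
    -- lie in `a j` there too. The Hardy part is `λ^(-(k-1)) (f - S)`.
    let v : ℕ → Cn n := fun j => if j < k - 1 then fourierCoeff (fun t : Angle => f t) j else 0
    have hv : ∀ j, v j ∈ a j := by
      intro j
      by_cases hj : j < k - 1
      · simpa only [v, if_pos hj] using hmem j hj
      · simp only [v, if_neg hj, Submodule.zero_mem]
    let S : Angle → Cn n := ∑ j ∈ Finset.range (k - 1), fun t : Angle => fourier (j : ℤ) t • v j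
    have hS : MemLp S 2 AddCircle.haarAddCircle :=
      memLp_finsetSum' _ fun j _ => memLp_fourier_smul _ (memLp_const_angle _)
    have hfS : MemLp ((fun t : Angle => f t) - S) 2 AddCircle.haarAddCircle :=
      (Lp.memLp f).sub hS
    have hg := memLp_fourier_smul (-((k - 1 : ℕ) : ℤ)) hfS
    refine ⟨v, hv, hg.toLp _, toLp_mem_hardy hg fun m hm => ?_, ?_⟩
    · rw [fourierCoeff_fourier_smul]
      have hsub : (fun t : Angle => f t) - S = (fun t : Angle => f t) + (-1 : ℂ) • S := by
        rw [neg_one_smul, sub_eq_add_neg]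
      have hSi : Integrable S AddCircle.haarAddCircle := hS.integrable (by norm_num)
      rw [hsub, fourierCoeff.add f.integrable (hSi.smul _), Pi.add_apply,
        fourierCoeff.const_smul, neg_one_smul, hcoef]
      -- The shifted index `m + (k - 1)` is either negative, where both `f` and `S` have coefficient
      -- zero, or at most `k - 2`, where they cancel.
      by_cases h0 : m - -((k - 1 : ℕ) : ℤ) < 0
      · rw [hneg _ h0, zero_add, neg_eq_zero]
        exact Finset.sum_eq_zero fun j _ => if_neg (by omega)
      · obtain ⟨j, hj⟩ : ∃ j : ℕ, m - -((k - 1 : ℕ) : ℤ) = j :=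
          ⟨(m - -((k - 1 : ℕ) : ℤ)).toNat, by omega⟩
        have hjk : j < k - 1 := by omega
        rw [hj, Finset.sum_eq_single j]
        · simp [v, hjk]
        · intro i _ hij
          exact if_neg (by exact_mod_cast hij.symm)
        · intro h
          exact absurd (Finset.mem_range.2 hjk) h
    · filter_upwards [hg.coeFn_toLp] with t ht
      rw [ht]
      simp only [toCircle_pow_eq_fourier]
      rw [smul_smul, ← fourier_add, add_neg_cancel, fourier_zero, one_smul]
      simp only [S, Pi.sub_apply, Finset.sum_apply]
      abel

theorem filteredHardy_congr {k : ℕ} {a b : ℕ → Submodule ℂ (Cn n)}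
    (h : ∀ j, j < k - 1 → a j = b j) : filteredHardy k a = filteredHardy k b := by
  ext f
  rw [mem_filteredHardy_iff, mem_filteredHardy_iff]
  exact and_congr_right fun _ => forall₂_congr fun j hj => by rw [h j hj]

/-- The component in `P_i` is multiplied by `λ^(i a)`, so its coefficients shift by `i a`. The loop
is the case `a = 1`, its inverse `a = -1`. -/
theorem fourierCoeff_gradedLoop (β : ℕ → Submodule ℂ (Cn n)) (K : ℕ) (a : ℤ) {g : Angle → Cn n}
    (hg : Integrable g AddCircle.haarAddCircle) (m : ℤ) :
    fourierCoeff (fun t => Matrix.toEuclideanLin (gradedLoop β K (fourier a t)) (g t)) m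
      = ∑ i ∈ Finset.range (K + 1),
          Matrix.toEuclideanLin (piece β i) (fourierCoeff g (m - i * a)) := by
  let L : ℕ → Cn n →L[ℂ] Cn n := fun i =>
    LinearMap.toContinuousLinearMap (Matrix.toEuclideanLin (piece β i))
  have h1 : (fun t => Matrix.toEuclideanLin (gradedLoop β K (fourier a t)) (g t))
      = ∑ i ∈ Finset.range (K + 1), fun t : Angle => fourier (i * a : ℤ) t • L i (g t) := by
    funext t
    rw [gradedLoop, toEuclideanLin_sum_apply, Finset.sum_apply]
    refine Finset.sum_congr rfl fun i _ => ?_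
    rw [map_smul, LinearMap.smul_apply, ← toCircle_zpow_eq_fourier, ← toCircle_zpow_eq_fourier,
      mul_comm, zpow_mul, zpow_natCast]
    rfl
  rw [h1, fourierCoeff.sum _ _ fun i _ => ((L i).integrable_comp hg).fourier_smul _,
    Finset.sum_apply]
  refine Finset.sum_congr rfl fun i _ => ?_
  rw [fourierCoeff_fourier_smul, fourierCoeff_clm _ hg]
  rfl

theorem continuous_gradedLoop_fourier (β : ℕ → Submodule ℂ (Cn n)) (K : ℕ) (a : ℤ)
    (i j : Fin n) : Continuous fun t : Angle => gradedLoop β K (fourier a t) i j := by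
  simp only [gradedLoop, Matrix.sum_apply, Matrix.smul_apply]
  fun_prop

/-- `(∑ λ^i P_i) H₊` is the filtered Hardy space. -/
theorem loopMul_gradedLoop_hardy {β : ℕ → Submodule ℂ (Cn n)} (hβ : Monotone β) {K : ℕ}
    (hK : β K = ⊤) :
    loopMul (fun l => gradedLoop β K l) (hardy n) = filteredHardy (K + 1) β := by
  ext f
  rw [mem_filteredHardy_iff]
  constructor
  · rintro ⟨g, hg, hf⟩
    have hf' : (fun t : Angle => f t) =ᵐ[AddCircle.haarAddCircle]
        fun t => Matrix.toEuclideanLin (gradedLoop β K (fourier 1 t)) (g t) := by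
      filter_upwards [hf] with t ht
      rw [ht, fourier_one]
    have hm : ∀ m : ℤ, fourierCoeff (fun t : Angle => f t) m = _ := fun m =>
      (congrFun (fourierCoeff_congr_ae hf') m).trans (fourierCoeff_gradedLoop β K 1 g.integrable m)
    refine ⟨fun m hm0 => ?_, fun j hj => ?_⟩
    · rw [hm]
      refine Finset.sum_eq_zero fun i _ => ?_
      rw [hg _ (by omega), map_zero]
    · rw [hm]
      refine Submodule.sum_mem _ fun i _ => ?_
      rcases le_or_gt i j with hij | hij
      · exact piece_apply_mem hβ hij _
      · rw [hg _ (by omega), map_zero]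
        exact Submodule.zero_mem _
  · rintro ⟨hneg, hmem⟩
    -- The preimage is the inverse loop applied to `f`. For `m < 0` its `P_i`-component uses the
    -- coefficient of `f` at `m + i < i`, which is zero or lies in `β (m + i)`; `P_i` kills it
    -- either way.
    have hg := memLp_toEuclideanLin (continuous_gradedLoop_fourier β K (-1)) (Lp.memLp f)
    refine ⟨hg.toLp _, toLp_mem_hardy hg fun m hm => ?_, ?_⟩
    · rw [fourierCoeff_gradedLoop β K (-1) f.integrable]
      refine Finset.sum_eq_zero fun i hi => ?_
      have hiK : i < K + 1 := Finset.mem_range.1 hi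
      by_cases h0 : m - i * -1 < 0
      · rw [hneg _ h0, map_zero]
      · obtain ⟨j, hj⟩ : ∃ j : ℕ, m - i * -1 = j := ⟨(m - i * -1).toNat, by omega⟩
        rw [hj]
        exact piece_apply_eq_zero hβ (by omega) (hmem j (by omega))
    · filter_upwards [hg.coeFn_toLp] with t ht
      rw [ht, ← toEuclideanLin_mul_apply, ← fourier_one, gradedLoop_mul hβ, ← fourier_add,
        add_neg_cancel, fourier_zero, gradedLoop_one hK, toEuclideanLin_one_apply]

/-- Continuity of `Θ` ensures that the intermediate function `Θ h` is again in `L²`. -/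
theorem loopMul_loopMul {Θ Φ : Circle → Matrix (Fin n) (Fin n) ℂ}
    (hΘ : ∀ i j, Continuous fun l => Θ l i j) (V : Submodule ℂ (L2 n)) :
    loopMul Φ (loopMul Θ V) = loopMul (fun l => Φ l * Θ l) V := by
  ext f
  constructor
  · rintro ⟨g, ⟨h, hh, hg⟩, hf⟩
    refine ⟨h, hh, ?_⟩
    filter_upwards [hf, hg] with t h1 h2
    rw [h1, h2, toEuclideanLin_mul_apply]
  · rintro ⟨h, hh, hf⟩
    have hg := memLp_toEuclideanLin (Θ := fun t => Θ (AddCircle.toCircle t))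
      (fun i j => (hΘ i j).comp AddCircle.continuous_toCircle) (Lp.memLp h)
    refine ⟨hg.toLp _, ⟨h, hh, hg.coeFn_toLp⟩, ?_⟩
    filter_upwards [hf, hg.coeFn_toLp] with t h1 h2
    rw [h1, h2, toEuclideanLin_mul_apply]

/-- The constant `e_j` lies in `H₊`, so `Θ e_j = Φ f` with `f ∈ H₊`; hence the column `Φ* Θ e_j = f`
has no negative coefficients. -/
theorem fourierCoeff_entry_eq_zero {Θ Φ : Circle → Matrix.unitaryGroup (Fin n) ℂ}
    (hΘ : ∀ i j, Continuous fun l => (Θ l : Matrix (Fin n) (Fin n) ℂ) i j)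
    (h : loopMul (fun l => (Θ l : Matrix (Fin n) (Fin n) ℂ)) (hardy n)
      ≤ loopMul (fun l => (Φ l : Matrix (Fin n) (Fin n) ℂ)) (hardy n)) (i j : Fin n) {m : ℤ}
    (hm : m < 0) :
    fourierCoeff (fun t : Angle =>
      ((Φ (AddCircle.toCircle t) : Matrix (Fin n) (Fin n) ℂ).conjTranspose
      * (Θ (AddCircle.toCircle t) : Matrix (Fin n) (Fin n) ℂ)) i j) m = 0 := by
  let v : Cn n := EuclideanSpace.single j 1
  have hv : (memLp_const_angle v).toLp _ ∈ hardy n := toLp_mem_hardy _ fun m hm => by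
    rw [fourierCoeff_const, if_neg hm.ne]
  have hg := memLp_toEuclideanLin
    (Θ := fun t => (Θ (AddCircle.toCircle t) : Matrix (Fin n) (Fin n) ℂ))
    (fun i j => (hΘ i j).comp AddCircle.continuous_toCircle) (memLp_const_angle v)
  have hmem : hg.toLp _ ∈ loopMul (fun l => (Θ l : Matrix (Fin n) (Fin n) ℂ)) (hardy n) := by
    refine ⟨_, hv, ?_⟩
    filter_upwards [hg.coeFn_toLp, (memLp_const_angle v).coeFn_toLp] with t h1 h2
    rw [h1, h2]
  obtain ⟨f, hf, hfe⟩ := h hmem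
  have hfi := hf m hm
  let L : Cn n →L[ℂ] ℂ := EuclideanSpace.proj i
  have h1 := fourierCoeff_clm L f.integrable m
  rw [hfi, map_zero] at h1
  rw [← h1]
  refine congrFun (fourierCoeff_congr_ae ?_) m
  filter_upwards [hfe, hg.coeFn_toLp] with t h2 h3
  rw [h3] at h2
  have h4 := congrArg (Matrix.toEuclideanLin
    (Φ (AddCircle.toCircle t) : Matrix (Fin n) (Fin n) ℂ).conjTranspose) h2
  rw [← toEuclideanLin_mul_apply, ← toEuclideanLin_mul_apply, unitaryGroup_conjTranspose_mul,
    toEuclideanLin_one_apply] at h4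
  rw [← h4]
  simp [L, v, Matrix.toLpLin_apply]
  rfl

/-- A continuous loop of unitary matrices is determined by its action on the Hardy space and its
value at `1`. -/
theorem loop_eq_of_loopMul_hardy_eq {Θ Φ : Circle → Matrix.unitaryGroup (Fin n) ℂ}
    (hΘ : ∀ i j, Continuous fun l => (Θ l : Matrix (Fin n) (Fin n) ℂ) i j)
    (hΦ : ∀ i j, Continuous fun l => (Φ l : Matrix (Fin n) (Fin n) ℂ) i j)
    (h1 : Θ 1 = Φ 1)
    (h : loopMul (fun l => (Θ l : Matrix (Fin n) (Fin n) ℂ)) (hardy n)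
      = loopMul (fun l => (Φ l : Matrix (Fin n) (Fin n) ℂ)) (hardy n)) (l : Circle) :
    Θ l = Φ l := by
  let G : Circle → Matrix (Fin n) (Fin n) ℂ := fun l =>
    (Φ l : Matrix (Fin n) (Fin n) ℂ).conjTranspose * (Θ l : Matrix (Fin n) (Fin n) ℂ)
  have hG : ∀ i j, Continuous fun l => G l i j := by
    intro i j
    simp only [G, Matrix.mul_apply, Matrix.conjTranspose_apply]
    exact continuous_finsetSum _ fun a _ => (hΦ a i).star.mul (hΘ a j)
  have hcoef : ∀ i j (m : ℤ), m ≠ 0 →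
      fourierCoeff (fun t : Angle => G (AddCircle.toCircle t) i j) m = 0 := by
    intro i j m hm
    rcases lt_or_gt_of_ne hm with hm | hm
    · exact fourierCoeff_entry_eq_zero hΘ h.le i j hm
    -- With the roles exchanged, `Θ* Φ` is the adjoint of `G`, and its negative coefficients are
    -- conjugates of the positive ones of `G`.
    · have h2 := fourierCoeff_entry_eq_zero hΦ h.ge j i (neg_lt_zero.2 hm)
      have h3 : (fun t : Angle =>
          ((Θ (AddCircle.toCircle t) : Matrix (Fin n) (Fin n) ℂ).conjTranspose
            * (Φ (AddCircle.toCircle t) : Matrix (Fin n) (Fin n) ℂ)) j i)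
          = fun t : Angle => star (G (AddCircle.toCircle t) i j) := by
        funext t
        rw [← Matrix.conjTranspose_apply]
        simp only [G, Matrix.conjTranspose_mul, Matrix.conjTranspose_conjTranspose]
      rw [h3, fourierCoeff_star, neg_neg] at h2
      exact star_eq_zero.1 h2
  obtain ⟨t, rfl⟩ : ∃ t : Angle, AddCircle.toCircle t = l :=
    ⟨_, (AddCircle.homeomorphCircle_apply one_ne_zero _).symm.trans
      ((AddCircle.homeomorphCircle one_ne_zero).apply_symm_apply l)⟩
  have hone : G (AddCircle.toCircle t) = 1 := by
    have : G (AddCircle.toCircle t) = G (AddCircle.toCircle (0 : Angle)) := by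
      ext i j
      exact eq_of_fourierCoeff_eq_zero ((hG i j).comp AddCircle.continuous_toCircle)
        (hcoef i j) t
    rw [this, AddCircle.toCircle_zero]
    simp only [G, h1, unitaryGroup_conjTranspose_mul]
  apply Subtype.ext
  calc (Θ (AddCircle.toCircle t) : Matrix (Fin n) (Fin n) ℂ)
      = Φ (AddCircle.toCircle t) * G (AddCircle.toCircle t) := by
        simp only [G]
        rw [← mul_assoc, unitaryGroup_mul_conjTranspose, one_mul]
    _ = Φ (AddCircle.toCircle t) := by rw [hone, mul_one]

end Loops

/-! ### The block form of the extended solution equation -/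

section Blocks

variable {n K : ℕ} {β : ℕ → Submodule ℂ (Cn n)}

theorem eq_sum_blocks (hK : β K = ⊤) (X : Matrix (Fin n) (Fin n) ℂ) :
    X = ∑ i ∈ Finset.range (K + 1), ∑ j ∈ Finset.range (K + 1), piece β i * X * piece β j := by
  simp only [← Finset.mul_sum, ← Finset.sum_mul, sum_piece_eq_one hK, one_mul, mul_one]

/-- If the blocks `P_i X(λ) P_j` of `X` have the form
`(λ^(j-i) - λ^(j-i-K-1)) P_i A P_j + (λ^(j-i) - 1) P_i D_j`, then `X(λ) = (1 - λ⁻¹) B` for some `B`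
if and only if certain blocks vanish. -/
theorem exists_eq_smul_iff_blocks (hK : β K = ⊤) (hK0 : 1 ≤ K)
    {X : Circle → Matrix (Fin n) (Fin n) ℂ} {A : Matrix (Fin n) (Fin n) ℂ}
    {D : ℕ → Matrix (Fin n) (Fin n) ℂ}
    (hX : ∀ (l : Circle) (i j : ℕ), i ≤ K → j ≤ K → piece β i * X l * piece β j
      = ((l : ℂ) ^ ((j : ℤ) - i) - (l : ℂ) ^ ((j : ℤ) - i - (K + 1))) • (piece β i * A * piece β j)
        + ((l : ℂ) ^ ((j : ℤ) - i) - 1) • (piece β i * D j)) :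
    (∃ B, ∀ l : Circle, X l = (1 - (l : ℂ)⁻¹) • B) ↔
      ∀ i j, i ≤ K → j ≤ K →
        (j ≠ i + K → piece β i * A * piece β j = 0) ∧
        (i < j → piece β i * A * piece β j + piece β i * D j = 0) ∧
        (j + 2 ≤ i → piece β i * D j = 0) := by
  constructor
  · rintro ⟨B, hB⟩ i j hi hj
    -- Write `P_i X P_j - (1 - λ⁻¹) P_i B P_j = 0` entrywise as a Laurent polynomial with exponents
    -- `j - i`, `j - i - (K + 1)`, `0`, `-1`. Coincidences among these exponents decide which
    -- coefficients must vanish alone.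
    have hcoef : ∀ (r s : Fin n) (m : ℤ), _ := fun r s m =>
      laurent_coeff_eq_zero (a := (piece β i * A * piece β j) r s + (piece β i * D j) r s)
        (b := -(piece β i * A * piece β j) r s)
        (c := -(piece β i * D j) r s - (piece β i * B * piece β j) r s)
        (d := (piece β i * B * piece β j) r s) (i := (j : ℤ) - i) (j := (j : ℤ) - i - (K + 1))
        (k := 0) (l := -1) (fun l => by
          have h := congrFun (congrFun (hX l i j hi hj) r) s
          rw [hB l, mul_smul_comm, smul_mul_assoc] at h
          simp only [Matrix.smul_apply, Matrix.add_apply, smul_eq_mul] at h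
          rw [zpow_zero, zpow_neg_one]
          linear_combination -h) m
    have hA : j ≠ i + K → piece β i * A * piece β j = 0 := by
      intro hne
      ext r s
      have h := hcoef r s ((j : ℤ) - i - (K + 1))
      rw [if_neg (by omega), if_pos rfl, if_neg (by omega), if_neg (by omega)] at h
      simpa using h
    have hAD : (j ≤ i → j + 2 ≤ i) → piece β i * A * piece β j + piece β i * D j = 0 := by
      intro hlt
      ext r s
      have h := hcoef r s ((j : ℤ) - i)
      rw [if_pos rfl, if_neg (by omega), if_neg (by omega), if_neg (by omega)] at h
      simpa using h
    refine ⟨hA, fun hij => hAD (by omega), fun hij => ?_⟩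
    have h := hAD (by omega)
    rwa [hA (by omega), zero_add] at h
  · intro h
    -- The surviving blocks: in the corner `(0, K)` the terms in `λ^K` cancel, leaving `(1 - λ⁻¹)
    -- P_0 A P_K`; just below the diagonal, `(λ⁻¹ - 1) P_i D_j` gives the sign.
    let b : ℕ → ℕ → Matrix (Fin n) (Fin n) ℂ := fun i j =>
      if j = i + K then piece β i * A * piece β j
      else if i = j + 1 then -(piece β i * D j) else 0
    refine ⟨∑ i ∈ Finset.range (K + 1), ∑ j ∈ Finset.range (K + 1), b i j, fun l => ?_⟩
    rw [eq_sum_blocks hK (X l), Finset.smul_sum]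
    refine Finset.sum_congr rfl fun i hi => ?_
    rw [Finset.smul_sum]
    refine Finset.sum_congr rfl fun j hj => ?_
    have hi' : i ≤ K := Nat.lt_succ_iff.1 (Finset.mem_range.1 hi)
    have hj' : j ≤ K := Nat.lt_succ_iff.1 (Finset.mem_range.1 hj)
    obtain ⟨h1, h2, h3⟩ := h i j hi' hj'
    rw [hX l i j hi' hj']
    simp only [b]
    by_cases hd : j = i + K
    · have hD : piece β i * D j = -(piece β i * A * piece β j) :=
        eq_neg_of_add_eq_zero_right (h2 (by omega))
      have he : (j : ℤ) - i - (K + 1) = -1 := by omega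
      rw [if_pos hd, hD, he, zpow_neg_one, smul_neg, ← sub_eq_add_neg, ← sub_smul]
      congr 1
      ring
    · rw [if_neg hd, h1 hd, smul_zero, zero_add]
      by_cases hij : i = j + 1
      · have he : (j : ℤ) - i = -1 := by omega
        rw [if_pos hij, he, zpow_neg_one, smul_neg, ← neg_smul, neg_sub]
      · rw [if_neg hij, smul_zero]
        rcases lt_trichotomy i j with hlt | heq | hgt
        · have := h2 hlt
          rw [h1 hd, zero_add] at this
          rw [this, smul_zero]
        · rw [heq, sub_self, zpow_zero, sub_self, zero_smul]
        · rw [h3 (by omega), smul_zero]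

end Blocks

section Filtration

variable {M : Type*} [TopologicalSpace M] [ChartedSpace ℂ M] {n K : ℕ}
  {β : M → ℕ → Submodule ℂ (Cn n)} {z : OpenPartialHomeomorph M ℂ} {p : M} {ε : ℂ}

theorem smooth_piece (hβ : ∀ i, MatSmoothOn (fun q => projMat (β q i)) Set.univ) (i : ℕ) :
    MatSmoothOn (fun q => piece (β q) i) Set.univ := by
  cases i with
  | zero => exact hβ 0
  | succ i =>
    intro a b
    exact (hβ (i + 1) a b).sub (hβ i a b)

theorem diffInCoord_of_matSmoothOn [IsManifold 𝓘(ℂ) ω M] {F : M → Matrix (Fin n) (Fin n) ℂ}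
    (hF : MatSmoothOn F Set.univ) (hz : IsCoord z) (hp : p ∈ z.source) (i j : Fin n) :
    DiffInCoord z (fun q => F q i j) p :=
  diffInCoord_of_contMDiffOn (hF i j) isOpen_univ (Set.mem_univ p) hz hp

end Filtration

theorem star_circle_coe (l : Circle) : star (l : ℂ) = (l : ℂ)⁻¹ := by
  rw [← Circle.coe_inv, Circle.coe_inv_eq_conj]; rfl

/-! ### Blocks of the derivatives of the graded pieces -/

section Derivatives

variable {M : Type*} [TopologicalSpace M] {n K : ℕ}
  {β : M → ℕ → Submodule ℂ (Cn n)} {z : OpenPartialHomeomorph M ℂ} {p : M} {ε : ℂ}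

theorem gradedLoop_diffInCoord (hd : ∀ i a b, DiffInCoord z (fun q => piece (β q) i a b) p)
    (l : ℂ) (a b : Fin n) : DiffInCoord z (fun q => gradedLoop (β q) K l a b) p := by
  simp only [gradedLoop, Matrix.sum_apply, Matrix.smul_apply, smul_eq_mul]
  exact DiffInCoord.sum fun c _ => (DiffInCoord.const _).mul (hd c a b)

/-- Differentiate `G P_j = λ^j P_j` and multiply by `P_i` on the left, using `P_i G = λ^i P_i`. -/
theorem piece_mul_matD_gradedLoop_mul_piece (hβ : ∀ q, Monotone (β q)) (hp : p ∈ z.source)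
    (hd : ∀ i a b, DiffInCoord z (fun q => piece (β q) i a b) p) (l : ℂ) {i j : ℕ} (hi : i ≤ K)
    (hj : j ≤ K) :
    piece (β p) i * matD ε z (fun q => gradedLoop (β q) K l) p * piece (β p) j
      = (l ^ j - l ^ i) • (piece (β p) i * matD ε z (fun q => piece (β q) j) p) := by
  have h := matD_mul (ε := ε) hp (gradedLoop_diffInCoord (K := K) hd l) (hd j)
  simp only [gradedLoop_mul_piece (hβ _) hj] at h
  rw [matD_const_smul _ hp (hd j)] at h
  have h' := congrArg (fun Y => piece (β p) i * Y) h
  simp only [mul_add, ← mul_assoc, piece_mul_gradedLoop (hβ p) hi, mul_smul_comm,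
    smul_mul_assoc] at h'
  rw [sub_smul, h', add_sub_cancel_right]

/-- The blocks of the logarithmic derivative of `φ (∑ λ^i P_i)`. -/
theorem piece_mul_logDz_mul_piece (hβ : ∀ q, Monotone (β q)) (hp : p ∈ z.source)
    (hd : ∀ i a b, DiffInCoord z (fun q => piece (β q) i a b) p) (l : Circle)
    {φ χ : M → Matrix.unitaryGroup (Fin n) ℂ}
    (hφ : ∀ a b, DiffInCoord z (fun q => (φ q : Matrix (Fin n) (Fin n) ℂ) a b) p)
    (hχ : ∀ q, (χ q : Matrix (Fin n) (Fin n) ℂ) = φ q * gradedLoop (β q) K l)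
    {A : Matrix (Fin n) (Fin n) ℂ} {k : ℕ} (hA : logDz z φ p = (1 - ((l ^ k : Circle) : ℂ)⁻¹) • A)
    {i j : ℕ} (hi : i ≤ K) (hj : j ≤ K) :
    piece (β p) i * logDz z χ p * piece (β p) j
      = ((l : ℂ) ^ ((j : ℤ) - i) - (l : ℂ) ^ ((j : ℤ) - i - k))
          • (piece (β p) i * A * piece (β p) j)
        + ((l : ℂ) ^ ((j : ℤ) - i) - 1)
          • (piece (β p) i * matD (-Complex.I) z (fun q => piece (β q) j) p) := by
  have hl : (l : ℂ) ≠ 0 := Circle.coe_ne_zero l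
  rw [logDz_eq_matD] at hA ⊢
  simp only [hχ]
  rw [matD_mul hp hφ (gradedLoop_diffInCoord hd _), Matrix.conjTranspose_mul,
    conjTranspose_gradedLoop, star_circle_coe, mul_add, mul_add, add_mul]
  -- The outer loops contribute `λ^(-i)` and `λ^j`, and `Ψ(λ^k)` contributes `1 - λ^(-k)`.
  have h1 : piece (β p) i * (gradedLoop (β p) K (l : ℂ)⁻¹
      * (φ p : Matrix (Fin n) (Fin n) ℂ).conjTranspose
      * (matD (-Complex.I) z (fun q => (φ q : Matrix (Fin n) (Fin n) ℂ)) p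
        * gradedLoop (β p) K l)) * piece (β p) j
      = ((l : ℂ) ^ ((j : ℤ) - i) - (l : ℂ) ^ ((j : ℤ) - i - k))
          • (piece (β p) i * A * piece (β p) j) := by
    calc _ = (piece (β p) i * gradedLoop (β p) K (l : ℂ)⁻¹)
          * ((φ p : Matrix (Fin n) (Fin n) ℂ).conjTranspose
            * matD (-Complex.I) z (fun q => (φ q : Matrix (Fin n) (Fin n) ℂ)) p)
          * (gradedLoop (β p) K l * piece (β p) j) := by simp only [mul_assoc]
      _ = _ := by
        rw [hA, piece_mul_gradedLoop (hβ p) hi, gradedLoop_mul_piece (hβ p) hj]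
        simp only [mul_smul_comm, smul_mul_assoc, smul_smul]
        congr 1
        simp only [zpow_sub₀ hl, zpow_natCast, inv_pow, Circle.coe_pow]
        field_simp
  have h2 : piece (β p) i * (gradedLoop (β p) K (l : ℂ)⁻¹
      * (φ p : Matrix (Fin n) (Fin n) ℂ).conjTranspose
      * ((φ p : Matrix (Fin n) (Fin n) ℂ)
        * matD (-Complex.I) z (fun q => gradedLoop (β q) K l) p)) * piece (β p) j
      = ((l : ℂ) ^ ((j : ℤ) - i) - 1)
          • (piece (β p) i * matD (-Complex.I) z (fun q => piece (β q) j) p) := by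
    calc _ = (piece (β p) i * gradedLoop (β p) K (l : ℂ)⁻¹)
          * ((φ p : Matrix (Fin n) (Fin n) ℂ).conjTranspose * (φ p : Matrix (Fin n) (Fin n) ℂ))
          * matD (-Complex.I) z (fun q => gradedLoop (β q) K l) p * piece (β p) j := by
            simp only [mul_assoc]
      _ = _ := by
        rw [unitaryGroup_conjTranspose_mul, mul_one, piece_mul_gradedLoop (hβ p) hi,
          smul_mul_assoc, smul_mul_assoc, piece_mul_matD_gradedLoop_mul_piece hβ hp hd _ hi hj,
          smul_smul]
        congr 1
        simp only [zpow_sub₀ hl, zpow_natCast, inv_pow]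
        field_simp
  rw [h1, h2]

/-- The components in `P_i`, `i > j`, of the derivative of a section of `β j`. -/
theorem piece_apply_vecD (hβ : ∀ q, Monotone (β q)) (hp : p ∈ z.source)
    (hd : ∀ i a b, DiffInCoord z (fun q => piece (β q) i a b) p) {s : M → Cn n} {U : Set M}
    (hU : IsOpen U) (hpU : p ∈ U) (hs : ∀ a, DiffInCoord z (fun q => s q a) p) {i j : ℕ}
    (hmem : ∀ q ∈ U, s q ∈ β q j) (hij : j < i) :
    Matrix.toEuclideanLin (piece (β p) i) (vecD ε z s p)
      = ∑ l ∈ Finset.range (j + 1),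
        Matrix.toEuclideanLin (piece (β p) i * matD ε z (fun q => piece (β q) l) p) (s p) := by
  -- Differentiate `s = (∑_{l ≤ j} P_l) s`; the term containing the derivative of `s` is killed by
  -- `P_i` since `i > j`.
  have hfix : s =ᶠ[nhds p] fun q => Matrix.toEuclideanLin
      (∑ l ∈ Finset.range (j + 1), piece (β q) l) (s q) := by
    filter_upwards [hU.mem_nhds hpU] with q hq
    rw [sum_piece, projMat_apply_eq_self_iff.2 (hmem q hq)]
  have hdS : ∀ a b, DiffInCoord z
      (fun q => (∑ l ∈ Finset.range (j + 1), piece (β q) l) a b) p := by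
    intro a b
    simp only [Matrix.sum_apply]
    exact DiffInCoord.sum fun l _ => hd l a b
  rw [vecD_congr hp hfix, vecD_toEuclideanLin hp hdS hs, map_add, ← toEuclideanLin_mul_apply,
    ← toEuclideanLin_mul_apply, sum_piece, piece_mul_projMat_of_lt (hβ p) hij, map_zero,
    LinearMap.zero_apply, add_zero, matD_sum _ fun l _ => hd l, Finset.mul_sum,
    toEuclideanLin_sum_apply]

theorem vecD_piece_apply (hp : p ∈ z.source)
    (hd : ∀ i a b, DiffInCoord z (fun q => piece (β q) i a b) p) (j : ℕ) (v : Cn n) :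
    vecD ε z (fun q => Matrix.toEuclideanLin (piece (β q) j) v) p
      = Matrix.toEuclideanLin (matD ε z (fun q => piece (β q) j) p) v := by
  have h := vecD_toEuclideanLin (ε := ε) (s := fun _ => v) hp (hd j) fun a => .const (v a)
  rw [h, vecD_const, map_zero, add_zero]

/-- The `∂_z̄`-blocks are minus the adjoints of the `∂_z`-blocks. -/
theorem piece_mul_matD_add (hβ : ∀ q, Monotone (β q)) (hp : p ∈ z.source)
    (hd : ∀ i a b, DiffInCoord z (fun q => piece (β q) i a b) p)
    (A : Matrix (Fin n) (Fin n) ℂ) {i j : ℕ} (hij : i ≠ j) :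
    piece (β p) j * matD Complex.I z (fun q => piece (β q) i) p
        + piece (β p) j * -A.conjTranspose * piece (β p) i
      = -(piece (β p) i * A * piece (β p) j
        + piece (β p) i * matD (-Complex.I) z (fun q => piece (β q) j) p).conjTranspose := by
  -- Differentiating `P_j P_i = 0` moves the derivative from `P_i` to `P_j`, where the adjoint needs
  -- it.
  have h := matD_mul (ε := Complex.I) hp (hd j) (hd i)
  simp only [piece_mul_of_ne (hβ _) hij.symm] at h
  rw [matD_const] at h
  have hstar : (matD (-Complex.I) z (fun q => piece (β q) j) p).conjTranspose
      = matD Complex.I z (fun q => piece (β q) j) p := by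
    have := matD_conjTranspose (ε := Complex.I) (z := z) (p := p) fun q => piece (β q) j
    simp only [conjTranspose_piece] at this
    rw [this]
    congr 2
    exact Complex.conj_I.symm
  simp only [Matrix.conjTranspose_add, Matrix.conjTranspose_mul, conjTranspose_piece, hstar,
    mul_neg, neg_mul, neg_add, ← mul_assoc]
  rw [eq_neg_of_add_eq_zero_right h.symm, add_comm]

end Derivatives

/-! ### Extended solutions from filtrations -/

/-- `Ψ(λ^k) ∑ λ^i P_i`. -/
def gradedTwist {M : Type*} {n : ℕ} {β : M → ℕ → Submodule ℂ (Cn n)} {K : ℕ}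
    (hβ : ∀ q, Monotone (β q)) (hK : ∀ q, β q K = ⊤) (k : ℕ)
    (Ψ : Circle → M → Matrix.unitaryGroup (Fin n) ℂ) (l : Circle) (p : M) : Matrix.unitaryGroup (Fin n) ℂ :=
  Ψ (l ^ k) p * ⟨gradedLoop (β p) K l, gradedLoop_mem_unitaryGroup (hβ p) (hK p) l⟩

theorem coe_gradedTwist {M : Type*} {n : ℕ} {β : M → ℕ → Submodule ℂ (Cn n)} {K : ℕ}
    (hβ : ∀ q, Monotone (β q)) (hK : ∀ q, β q K = ⊤)
    {Ψ : Circle → M → Matrix.unitaryGroup (Fin n) ℂ} (k : ℕ) (l : Circle) (p : M) :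
    (gradedTwist hβ hK k Ψ l p : Matrix (Fin n) (Fin n) ℂ)
      = Ψ (l ^ k) p * gradedLoop (β p) K l := rfl

theorem loopMul_gradedTwist {M : Type*} {n : ℕ} {β : M → ℕ → Submodule ℂ (Cn n)} {K : ℕ}
    (hβ : ∀ q, Monotone (β q)) (hK : ∀ q, β q K = ⊤)
    {Ψ : Circle → M → Matrix.unitaryGroup (Fin n) ℂ} (k : ℕ) (p : M) :
    loopMul (fun l => (gradedTwist hβ hK k Ψ l p : Matrix (Fin n) (Fin n) ℂ)) (hardy n)
      = loopMul (fun l => (Ψ (l ^ k) p : Matrix (Fin n) (Fin n) ℂ))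
        (filteredHardy (K + 1) (β p)) := by
  simp only [coe_gradedTwist]
  rw [← loopMul_gradedLoop_hardy (hβ p) (hK p), loopMul_loopMul]
  intro i j
  simp only [gradedLoop, Matrix.sum_apply, Matrix.smul_apply, smul_eq_mul]
  exact continuous_finsetSum _ fun a _ => (continuous_subtype_val.pow a).mul continuous_const

/-! ### Reduction to one equation for the twisted loop -/

section ExtendedSolutions

variable {M : Type*} [TopologicalSpace M] [ChartedSpace ℂ M] {n : ℕ}

theorem IsExtendedSolution.matSmoothOn {Ψ : Circle → M → Matrix.unitaryGroup (Fin n) ℂ}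
    (hΨ : IsExtendedSolution Ψ) (l : Circle) :
    MatSmoothOn (fun q => (Ψ l q : Matrix (Fin n) (Fin n) ℂ)) Set.univ := fun i j =>
  ((hΨ.smooth i j).comp
    ((contMDiff_const (c := l)).prodMk contMDiff_id)).contMDiffOn

theorem IsExtendedSolution.continuous {Ψ : Circle → M → Matrix.unitaryGroup (Fin n) ℂ}
    (hΨ : IsExtendedSolution Ψ) (p : M) (i j : Fin n) :
    Continuous fun l => (Ψ l p : Matrix (Fin n) (Fin n) ℂ) i j :=
  (hΨ.smooth i j).continuous.comp (continuous_id.prodMk continuous_const)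

/-- At `λ = -1` the factor `1 - λ⁻¹` equals `2`, so the coefficient `A_z` of `Ψ` is `A_z^ψ`. -/
theorem IsExtendedSolution.logDz_eq {Ψ : Circle → M → Matrix.unitaryGroup (Fin n) ℂ}
    (hΨ : IsExtendedSolution Ψ) {z : OpenPartialHomeomorph M ℂ} (hz : IsCoord z) {p : M}
    (hp : p ∈ z.source) (l : Circle) :
    logDz z (Ψ l) p = (1 - (l : ℂ)⁻¹) • connZ z (Ψ (-1)) p := by
  obtain ⟨A, B, h⟩ := hΨ.eqn z hz
  have h1 : connZ z (Ψ (-1)) p = A p := by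
    rw [connZ, (h (-1) p hp).1, smul_smul]
    have : ((-1 : Circle) : ℂ) = -1 := by simp
    rw [this]
    norm_num
  rw [h1, (h l p hp).1]

theorem connZbar_eq_neg_conjTranspose [IsManifold 𝓘(ℂ) ω M]
    {φ : M → Matrix.unitaryGroup (Fin n) ℂ}
    (hφ : MatSmoothOn (fun q => (φ q : Matrix (Fin n) (Fin n) ℂ)) Set.univ)
    {z : OpenPartialHomeomorph M ℂ} (hz : IsCoord z) {p : M} (hp : p ∈ z.source) :
    connZbar z φ p = -(connZ z φ p).conjTranspose := by
  rw [connZbar, connZ, logDzbar_eq_neg_conjTranspose hp (diffInCoord_of_matSmoothOn hφ hz hp),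
    Matrix.conjTranspose_smul, smul_neg]
  congr 2
  simp

/-- For a smooth loop of unitary maps the `z̄`-part of the extended solution equation follows from
the `z`-part. -/
theorem isExtendedSolution_iff [IsManifold 𝓘(ℂ) ω M]
    {Φ : Circle → M → Matrix.unitaryGroup (Fin n) ℂ}
    (hs : ∀ i j, ContMDiff ((𝓡 1).prod 𝓘(ℝ, ℂ)) 𝓘(ℝ, ℂ) ∞
      (fun q : Circle × M => (Φ q.1 q.2 : Matrix (Fin n) (Fin n) ℂ) i j))
    (h1 : ∀ p, Φ 1 p = 1) :
    IsExtendedSolution Φ ↔ ∀ z : OpenPartialHomeomorph M ℂ, IsCoord z → ∀ p ∈ z.source,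
      ∃ B, ∀ l : Circle, logDz z (Φ l) p = (1 - (l : ℂ)⁻¹) • B := by
  refine ⟨fun h z hz p hp => ⟨_, h.logDz_eq hz hp⟩, fun h => ⟨hs, h1, fun z hz => ?_⟩⟩
  choose! B hB using h z hz
  -- On the circle the conjugate of `1 - λ⁻¹` is `1 - λ`, so `-B*` is the `z̄`-coefficient.
  refine ⟨B, fun p => -(B p).conjTranspose, fun l p hp => ⟨hB p hp l, ?_⟩⟩
  have hsm : MatSmoothOn (fun q => (Φ l q : Matrix (Fin n) (Fin n) ℂ)) Set.univ := fun i j =>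
    ((hs i j).comp ((contMDiff_const (c := l)).prodMk contMDiff_id)).contMDiffOn
  rw [logDzbar_eq_neg_conjTranspose hp (diffInCoord_of_matSmoothOn hsm hz hp), hB p hp l,
    Matrix.conjTranspose_smul, smul_neg, star_sub, star_one, star_inv₀]
  rw [star_circle_coe, inv_inv]

variable {β : M → ℕ → Submodule ℂ (Cn n)} {K : ℕ} (hβ : ∀ q, Monotone (β q))
  (hK : ∀ q, β q K = ⊤) {Ψ : Circle → M → Matrix.unitaryGroup (Fin n) ℂ}

theorem gradedTwist_one (hΨ : IsExtendedSolution Ψ) (k : ℕ) (p : M) :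
    gradedTwist hβ hK k Ψ 1 p = 1 := by
  apply Subtype.ext
  rw [coe_gradedTwist, one_pow, hΨ.map_one, Circle.coe_one, gradedLoop_one (hK p)]
  simp

theorem contMDiff_gradedTwist (hΨ : IsExtendedSolution Ψ)
    (hs : ∀ i, MatSmoothOn (fun q => piece (β q) i) Set.univ) (k : ℕ) (i j : Fin n) :
    ContMDiff ((𝓡 1).prod 𝓘(ℝ, ℂ)) 𝓘(ℝ, ℂ) ∞
      (fun q : Circle × M => (gradedTwist hβ hK k Ψ q.1 q.2 : Matrix (Fin n) (Fin n) ℂ) i j) := by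
  simp only [coe_gradedTwist, Matrix.mul_apply, gradedLoop, Matrix.sum_apply, Matrix.smul_apply,
    smul_eq_mul]
  have hpow : ContMDiff ((𝓡 1).prod 𝓘(ℝ, ℂ)) (𝓡 1) ∞ fun q : Circle × M => q.1 ^ k :=
    contMDiff_fst.pow k
  have hcoe : ContMDiff ((𝓡 1).prod 𝓘(ℝ, ℂ)) 𝓘(ℝ, ℂ) ∞ fun q : Circle × M => (q.1 : ℂ) :=
    have := finrank_real_complex_fact'
    (contMDiff_coe_sphere (n := 1) (E := ℂ)).comp contMDiff_fst
  refine contMDiff_finsetSum fun a _ => ContMDiff.mul ?_ (contMDiff_finsetSum fun b _ =>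
    (hcoe.pow b).mul ((contMDiffOn_univ.1 (hs b a j)).comp contMDiff_snd))
  exact (hΨ.smooth i a).comp (hpow.prodMk contMDiff_snd)

/-- Any extended solution generating the family agrees with the twisted loop at `λ = 1` and on `H₊`,
so uniqueness removes the existential quantifier. -/
theorem isExtendedSolutionFamily_iff (hΨ : IsExtendedSolution Ψ)
    (hs : ∀ i, MatSmoothOn (fun q => piece (β q) i) Set.univ) (k : ℕ) :
    IsExtendedSolutionFamily (fun p => loopMul
        (fun l => (Ψ (l ^ k) p : Matrix (Fin n) (Fin n) ℂ)) (filteredHardy (K + 1) (β p))) ↔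
      IsExtendedSolution (gradedTwist hβ hK k Ψ) := by
  constructor
  · rintro ⟨Φ, hΦ, hW⟩
    have : gradedTwist hβ hK k Ψ = Φ := by
      funext l p
      refine loop_eq_of_loopMul_hardy_eq (Θ := fun l => gradedTwist hβ hK k Ψ l p)
        (Φ := fun l => Φ l p) (fun i j => ?_) (hΦ.continuous p) ?_ ?_ l
      · exact (contMDiff_gradedTwist hβ hK hΨ hs k i j).continuous.comp
          (continuous_id.prodMk continuous_const)
      · simp only [gradedTwist_one hβ hK hΨ, hΦ.map_one]
      · rw [loopMul_gradedTwist, ← hW p]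
    rwa [this]
  · exact fun h => ⟨_, h, fun p => (loopMul_gradedTwist hβ hK k p).symm⟩

end ExtendedSolutions

/-- The family attached to a filtration `β 0 ⊆ ⋯ ⊆ β K = ℂⁿ` is an extended solution if and only if
certain blocks of `A_z^ψ` and of the derivatives of the graded pieces vanish. -/
theorem isExtendedSolutionFamily_iff_blocks {M : Type*} [TopologicalSpace M] [ChartedSpace ℂ M]
    [IsManifold 𝓘(ℂ) ω M] {n K : ℕ} {β : M → ℕ → Submodule ℂ (Cn n)}
    (hβ : ∀ q, Monotone (β q)) (hK : ∀ q, β q K = ⊤)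
    {Ψ : Circle → M → Matrix.unitaryGroup (Fin n) ℂ} (hΨ : IsExtendedSolution Ψ)
    (hs : ∀ i, MatSmoothOn (fun q => piece (β q) i) Set.univ) (hK0 : 1 ≤ K) :
    IsExtendedSolutionFamily (fun p => loopMul
        (fun l => (Ψ (l ^ (K + 1)) p : Matrix (Fin n) (Fin n) ℂ))
        (filteredHardy (K + 1) (β p))) ↔
      ∀ z : OpenPartialHomeomorph M ℂ, IsCoord z → ∀ p ∈ z.source, ∀ i j, i ≤ K → j ≤ K →
        (j ≠ i + K → piece (β p) i * connZ z (Ψ (-1)) p * piece (β p) j = 0) ∧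
        (i < j → piece (β p) i * connZ z (Ψ (-1)) p * piece (β p) j
          + piece (β p) i * matD (-Complex.I) z (fun q => piece (β q) j) p = 0) ∧
        (j + 2 ≤ i → piece (β p) i * matD (-Complex.I) z (fun q => piece (β q) j) p = 0) := by
  rw [isExtendedSolutionFamily_iff hβ hK hΨ hs, isExtendedSolution_iff
    (contMDiff_gradedTwist hβ hK hΨ hs _) (gradedTwist_one hβ hK hΨ _)]
  refine forall₄_congr fun z hz p hp => ?_
  refine exists_eq_smul_iff_blocks (D := fun j => matD (-Complex.I) z (fun q => piece (β q) j) p)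
    (hK p) hK0 fun l i j hi hj => ?_
  have := piece_mul_logDz_mul_piece (k := K + 1) hβ hp
    (fun i => diffInCoord_of_matSmoothOn (hs i) hz hp) l
    (diffInCoord_of_matSmoothOn (hΨ.matSmoothOn (l ^ (K + 1))) hz hp)
    (coe_gradedTwist hβ hK (K + 1) l) (hΨ.logDz_eq hz hp _) hi hj
  rw [this]
  norm_cast

/-! ### Filtrations extended by the whole space -/

/-- The filtration `a 0, …, a (K - 1), ℂⁿ, ℂⁿ, …`. -/
def fillTop {n : ℕ} (K : ℕ) (a : ℕ → Submodule ℂ (Cn n)) (j : ℕ) : Submodule ℂ (Cn n) :=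
  if j < K then a j else ⊤

section FillTop

variable {n K : ℕ} {a : ℕ → Submodule ℂ (Cn n)}

theorem fillTop_of_lt {j : ℕ} (h : j < K) : fillTop K a j = a j := if_pos h

theorem fillTop_self : fillTop K a K = ⊤ := if_neg (lt_irrefl K)

theorem monotone_fillTop (h : ∀ j, j + 1 < K → a j ≤ a (j + 1)) : Monotone (fillTop K a) := by
  refine monotone_nat_of_le_succ fun j => ?_
  by_cases hj : j + 1 < K
  · rw [fillTop_of_lt hj, fillTop_of_lt (by omega)]
    exact h j hj
  · have : fillTop K a (j + 1) = ⊤ := if_neg hj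
    rw [this]
    exact le_top

theorem smooth_projMat_fillTop {M : Type*} [TopologicalSpace M] [ChartedSpace ℂ M]
    {α : ℕ → M → Submodule ℂ (Cn n)} (hα : ∀ j, j < K → IsSmoothSubbundle (α j)) (i : ℕ) :
    MatSmoothOn (fun q => projMat (fillTop K (fun j => α j q) i)) Set.univ := by
  by_cases hi : i < K
  · simp only [fillTop_of_lt hi]
    exact (hα i hi).smooth_projMat
  · simp only [fillTop, if_neg hi]
    exact fun _ _ => contMDiffOn_const

end FillTop

/-! ### The conditions on the filtration in terms of blocks -/

/-- Only the block `P_0 A P_K` is nonzero if and only if `β (K - 1) ⊆ ker A` and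
`Im A ⊆ β 0`. -/
theorem ker_range_iff_blocks {n K : ℕ} {β : ℕ → Submodule ℂ (Cn n)} (hβ : Monotone β)
    (hK : β K = ⊤) (hK0 : 1 ≤ K) (A : Matrix (Fin n) (Fin n) ℂ) :
    (β (K - 1) ≤ LinearMap.ker (Matrix.toEuclideanLin A) ∧
      LinearMap.range (Matrix.toEuclideanLin A) ≤ β 0) ↔
    ∀ i j, i ≤ K → j ≤ K → j ≠ i + K → piece β i * A * piece β j = 0 := by
  constructor
  · rintro ⟨hker, hrange⟩ i j hi hj hne
    refine matrix_ext_of_toEuclideanLin fun x => ?_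
    rw [toEuclideanLin_mul_apply, toEuclideanLin_mul_apply, map_zero, LinearMap.zero_apply]
    -- Away from the corner `(0, K)`: if `j = K` then `i > 0` and `P_i` kills `Im A ⊆ β 0`; if `j <
    -- K` then `P_j` maps into `β (K - 1) ⊆ ker A`.
    by_cases hjK : j = K
    · exact piece_apply_eq_zero hβ (by omega : 0 < i) (hrange (LinearMap.mem_range_self _ _))
    · have : Matrix.toEuclideanLin A (Matrix.toEuclideanLin (piece β j) x) = 0 :=
        LinearMap.mem_ker.1 (hker (piece_apply_mem hβ (by omega) x))
      rw [this, map_zero]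
  · intro h
    have hA : A = piece β 0 * A * piece β K := by
      conv_lhs => rw [eq_sum_blocks hK A]
      rw [Finset.sum_eq_single 0, Finset.sum_eq_single K]
      · intro j hj hne
        exact h 0 j (by omega) (Nat.lt_succ_iff.1 (Finset.mem_range.1 hj)) (by omega)
      · intro h; simp at h
      · intro i hi hne
        refine Finset.sum_eq_zero fun j hj => ?_
        exact h i j (Nat.lt_succ_iff.1 (Finset.mem_range.1 hi))
          (Nat.lt_succ_iff.1 (Finset.mem_range.1 hj))
          (by have := Finset.mem_range.1 hj; omega)
      · intro h; simp at h
    refine ⟨fun x hx => ?_, ?_⟩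
    · rw [LinearMap.mem_ker, hA, toEuclideanLin_mul_apply,
        piece_apply_eq_zero hβ (by omega : K - 1 < K) hx, map_zero]
    · rintro _ ⟨x, rfl⟩
      rw [hA, mul_assoc, toEuclideanLin_mul_apply]
      exact piece_apply_mem hβ le_rfl _

/-! ### Derivative conditions tested on sections -/

section Sections

variable {M : Type*} [TopologicalSpace M] [ChartedSpace ℂ M] {n K : ℕ}
  {β : M → ℕ → Submodule ℂ (Cn n)}

theorem isSection_piece (hβ : ∀ q, Monotone (β q))
    (hs : ∀ i, MatSmoothOn (fun q => piece (β q) i) Set.univ) (j : ℕ) (v : Cn n) (U : Set M) :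
    IsSection (fun q => β q j) U fun q => Matrix.toEuclideanLin (piece (β q) j) v := by
  refine ⟨fun a => ?_, fun q _ => piece_apply_mem (hβ q) le_rfl v⟩
  simp only [Matrix.toLpLin_apply, Matrix.mulVec, dotProduct]
  exact (contMDiffOn_finsetSum fun b _ => (hs j a b).mul contMDiffOn_const).mono
    (Set.subset_univ U)

variable [IsManifold 𝓘(ℂ) ω M]

theorem IsSection.diffInCoord {α : M → Submodule ℂ (Cn n)} {U : Set M} {s : M → Cn n}
    (hs : IsSection α U s) (hU : IsOpen U) {z : OpenPartialHomeomorph M ℂ} (hz : IsCoord z)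
    (hUz : U ⊆ z.source) {p : M} (hp : p ∈ U) (a : Fin n) : DiffInCoord z (fun q => s q a) p :=
  diffInCoord_of_contMDiffOn (hs.1 a) hU hp hz (hUz hp)

/-- `∂_z β_j ⊆ β_(j+1)` for all `j` in terms of the graded pieces. -/
theorem dzMapsInto_iff_blocks (hβ : ∀ q, Monotone (β q)) (hK : ∀ q, β q K = ⊤)
    (hs : ∀ i, MatSmoothOn (fun q => piece (β q) i) Set.univ) :
    (∀ j, j + 1 < K → DzMapsInto (fun q => β q j) fun q => β q (j + 1)) ↔
      ∀ z : OpenPartialHomeomorph M ℂ, IsCoord z → ∀ p ∈ z.source, ∀ i j, i ≤ K → j + 2 ≤ i →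
        piece (β p) i * matD (-Complex.I) z (fun q => piece (β q) j) p = 0 := by
  constructor
  · intro h z hz p hp i j hi hij
    refine matrix_ext_of_toEuclideanLin fun v => ?_
    -- The sections `P_j v` with `v` constant are enough: their derivatives are `(∂_z P_j) v`.
    have h1 := h j (by omega) z hz z.source z.open_source subset_rfl _
      (isSection_piece hβ hs j v z.source) p hp
    rw [dzVec_eq_vecD, vecD_piece_apply hp fun i => diffInCoord_of_matSmoothOn (hs i) hz hp] at h1
    rw [toEuclideanLin_mul_apply, piece_apply_eq_zero (hβ p) (by omega) h1, map_zero,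
      LinearMap.zero_apply]
  · intro h j hj z hz U hU hUz s hsec p hp
    rw [mem_iff_piece_apply_eq_zero (hβ p) (hK p)]
    intro i hi hiK
    rw [dzVec_eq_vecD, piece_apply_vecD hβ (hUz hp)
      (fun i => diffInCoord_of_matSmoothOn (hs i) hz (hUz hp)) hU hp
      (hsec.diffInCoord hU hz hUz hp) hsec.2 (by omega : j < i)]
    refine Finset.sum_eq_zero fun l hl => ?_
    have := Finset.mem_range.1 hl
    rw [h z hz p (hUz hp) i l hiK (by omega), map_zero, LinearMap.zero_apply]

/-- Closedness of the `β_j` under `∂_z̄ + A_z̄^ψ` in terms of the graded pieces. -/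
theorem closedUnderDzbar_iff_blocks (hβ : ∀ q, Monotone (β q)) (hK : ∀ q, β q K = ⊤)
    (hs : ∀ i, MatSmoothOn (fun q => piece (β q) i) Set.univ)
    {ψ : M → Matrix.unitaryGroup (Fin n) ℂ}
    (hψ : MatSmoothOn (fun q => (ψ q : Matrix (Fin n) (Fin n) ℂ)) Set.univ) :
    (∀ j, j < K → ClosedUnderDzbar ψ fun q => β q j) ↔
      ∀ z : OpenPartialHomeomorph M ℂ, IsCoord z → ∀ p ∈ z.source, ∀ i j, j ≤ K → i < j →
        piece (β p) i * connZ z ψ p * piece (β p) j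
          + piece (β p) i * matD (-Complex.I) z (fun q => piece (β q) j) p = 0 := by
  constructor
  · intro h z hz p hp i j hj hij
    have hd := fun i => diffInCoord_of_matSmoothOn (hs i) hz hp
    have key := piece_mul_matD_add hβ hp hd (connZ z ψ p) hij.ne
    have h0 : piece (β p) j * matD Complex.I z (fun q => piece (β q) i) p
        + piece (β p) j * -(connZ z ψ p).conjTranspose * piece (β p) i = 0 := by
      refine matrix_ext_of_toEuclideanLin fun v => ?_
      have h1 := h i (by omega) z hz z.source z.open_source subset_rfl _
        (isSection_piece hβ hs i v z.source) p hp
      rw [dzbarVec_eq_vecD, vecD_piece_apply hp hd, connZbar_eq_neg_conjTranspose hψ hz hp] at h1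
      have h2 := piece_apply_eq_zero (hβ p) hij h1
      rw [map_add] at h2
      rw [map_add, LinearMap.add_apply, toEuclideanLin_mul_apply, toEuclideanLin_mul_apply,
        toEuclideanLin_mul_apply, h2, map_zero, LinearMap.zero_apply]
    rw [h0] at key
    exact Matrix.conjTranspose_eq_zero.1 (neg_eq_zero.1 key.symm)
  · intro h j hj z hz U hU hUz s hsec p hp
    have hd := fun i => diffInCoord_of_matSmoothOn (hs i) hz (hUz hp)
    rw [mem_iff_piece_apply_eq_zero (hβ p) (hK p)]
    intro i hi hiK
    have hfix : s p = ∑ l ∈ Finset.range (j + 1), Matrix.toEuclideanLin (piece (β p) l) (s p) := by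
      rw [← toEuclideanLin_sum_apply, sum_piece, projMat_apply_eq_self_iff.2 (hsec.2 p hp)]
    rw [map_add, dzbarVec_eq_vecD, piece_apply_vecD hβ (hUz hp) hd hU hp
      (hsec.diffInCoord hU hz hUz hp) hsec.2 hi, connZbar_eq_neg_conjTranspose hψ hz (hUz hp)]
    -- Splitting the argument of the connection term into its pieces `P_l s` pairs it with the
    -- derivative sum; each pair is the adjoint of the block in position `(l, i)`.
    nth_rw 2 [hfix]
    rw [map_sum, map_sum, ← Finset.sum_add_distrib]
    refine Finset.sum_eq_zero fun l hl => ?_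
    have hlj := Finset.mem_range.1 hl
    have key := piece_mul_matD_add hβ (hUz hp) hd (connZ z ψ p) (by omega : l ≠ i)
    rw [h z hz p (hUz hp) l i hiK (by omega), Matrix.conjTranspose_zero, neg_zero] at key
    have := congrArg (fun Y => Matrix.toEuclideanLin Y (s p)) key
    simpa only [map_add, LinearMap.add_apply, toEuclideanLin_mul_apply, map_zero,
      LinearMap.zero_apply] using this

end Sections

end HarmonicLoop

end

/-! ### The characterisation -/

theorem theorem3p2 {M : Type*} [TopologicalSpace M] [ChartedSpace ℂ M]
    [IsManifold 𝓘(ℂ) ω M] {n k : ℕ} (hk : 2 ≤ k)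
    (Ψ : Circle → M → Matrix.unitaryGroup (Fin n) ℂ) (hΨ : IsExtendedSolution Ψ)
    (α : ℕ → M → Submodule ℂ (Cn n))
    (hα : ∀ j, j ≤ k - 2 → IsSmoothSubbundle (α j))
    (hmono : ∀ j, j < k - 2 → ∀ p, α j p ≤ α (j + 1) p) :
    IsExtendedSolutionFamily (fun p =>
        loopMul (fun l => (Ψ (l ^ k) p : Matrix (Fin n) (Fin n) ℂ))
          (filteredHardy k fun j => α j p)) ↔
      (∀ j, j < k - 2 → DzMapsInto (α j) (α (j + 1))) ∧
      (∀ z : OpenPartialHomeomorph M ℂ, IsCoord z → ∀ p ∈ z.source,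
        α (k - 2) p ≤ LinearMap.ker (Matrix.toEuclideanLin (connZ z (Ψ (-1)) p)) ∧
        LinearMap.range (Matrix.toEuclideanLin (connZ z (Ψ (-1)) p)) ≤ α 0 p) ∧
      (∀ j, j ≤ k - 2 → ClosedUnderDzbar (Ψ (-1)) (α j)) := by
  obtain ⟨K, rfl⟩ : ∃ K, k = K + 1 := ⟨k - 1, by omega⟩
  have hK0 : 1 ≤ K := by omega
  -- The members of `α` beyond `k - 2 = K - 1` are arbitrary; replacing them by `ℂⁿ` gives a genuine
  -- filtration without changing the filtered Hardy space.
  let β : M → ℕ → Submodule ℂ (Cn n) := fun q => fillTop K fun j => α j q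
  have hβ : ∀ q, Monotone (β q) := fun q =>
    monotone_fillTop fun j hj => hmono j (by omega) q
  have hK : ∀ q, β q K = ⊤ := fun q => fillTop_self
  have hs := smooth_piece (β := β) (smooth_projMat_fillTop fun j hj => hα j (by omega))
  have hβα : ∀ j, j < K → (fun q => β q j) = α j := fun j hj =>
    funext fun q => fillTop_of_lt hj
  have hF : ∀ p, filteredHardy (K + 1) (fun j => α j p) = filteredHardy (K + 1) (β p) := fun p =>
    filteredHardy_congr fun j hj => (congrFun (hβα j hj) p).symm
  simp only [hF]
  rw [isExtendedSolutionFamily_iff_blocks hβ hK hΨ hs hK0]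
  have h1 : (∀ j, j < K + 1 - 2 → DzMapsInto (α j) (α (j + 1))) ↔
      ∀ j, j + 1 < K → DzMapsInto (fun q => β q j) fun q => β q (j + 1) :=
    forall_congr' fun j => by
      rw [show j < K + 1 - 2 ↔ j + 1 < K by omega]
      exact forall_congr' fun hj => by rw [hβα j (by omega), hβα (j + 1) hj]
  have h2 : ∀ p, α (K + 1 - 2) p = β p (K - 1) := fun p =>
    (congrFun (hβα (K - 1) (by omega)) p).symm
  have h2' : ∀ p, α 0 p = β p 0 := fun p => (congrFun (hβα 0 hK0) p).symm
  have h3 : (∀ j, j ≤ K + 1 - 2 → ClosedUnderDzbar (Ψ (-1)) (α j)) ↔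
      ∀ j, j < K → ClosedUnderDzbar (Ψ (-1)) fun q => β q j :=
    forall_congr' fun j => by
      rw [show j ≤ K + 1 - 2 ↔ j < K by omega]
      exact forall_congr' fun hj => by rw [hβα j hj]
  rw [h1, h3, dzMapsInto_iff_blocks hβ hK hs,
    closedUnderDzbar_iff_blocks hβ hK hs (hΨ.matSmoothOn (-1))]
  simp only [h2, h2', ker_range_iff_blocks (hβ _) (hK _) hK0]
  -- Both sides are now the same three groups of block equations, differing only in grouping and
  -- index bounds.
  constructor
  · intro h
    exact ⟨fun z hz p hp i j hi hij => (h z hz p hp i j hi (by omega)).2.2 hij,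
      fun z hz p hp i j hi hj => (h z hz p hp i j hi hj).1,
      fun z hz p hp i j hj hij => (h z hz p hp i j (by omega) hj).2.1 hij⟩
  · rintro ⟨hi, hii, hiii⟩ z hz p hp i j hi' hj'
    exact ⟨hii z hz p hp i j hi' hj', hiii z hz p hp i j hj', hi z hz p hp i j hi'⟩
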